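/- Let $\mathbb{T}=\mathbb{R}/2\pi\mathbb{Z}$ (identified with $(-\pi,\pi]$) and $\mathbb{D}=\{z\in\mathbb{C}:|z|<1\}$. For a probability measure $F$ on $\mathbb{T}$ put $$K_F(z,w)=\int_{\mathbb{T}} s(z,t)\,\overline{s(w,t)}\,F(dt),\qquad s(z,t)=\frac{1}{1-ze^{-it}}\qquad(z,w\in\mathbb{D},\ t\in\mathbb{T}),$$ and let $X_F$ denote the Gaussian analytic function (GAF) on $\mathbb{D}$ with covariance kernel $K_F$. That is, $X_F$ is a random element of the space $\mathcal{H}(\mathbb{D})$ of analytic functions on $\mathbb{D}$ (with the topology of uniform convergence on compact sets and its Borel $\sigma$-algebra) such that $(X_F(z))_{z\in\mathbb{D}}$ is a centered, circularly symmetric complex Gaussian process with $\mathbb{E}[X_F(z)\overline{X_F(w)}]=K_F(z,w)$ for all $z,w\in\mathbb{D}$. Let $F_n$ ($n=1,2,\dots$) and $F$ be probability measures on $\mathbb{T}$ such that $F_n$ converges weakly to $F$. Then $X_{F_n}$ converges in law to $X_F$ in $\mathcal{H}(\mathbb{D})$ as $n\to\infty$. Moreover, the zero processes $\mathcal{Z}_{X_{F_n}}$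 converge in law to $\mathcal{Z}_{X_F}$, where $\mathcal{Z}_X=\sum_{z\in\mathbb{D}:X(z)=0}\delta_z$ (zeros counted with multiplicity) is regarded as a random element of the space of integer-valued Radon measures on $\mathbb{D}$ with the vague topology. -/

import Mathlib

open MeasureTheory ProbabilityTheory Filter Topology
open scoped ENNReal CompactlySupported

noncomputable section

namespace SpectralGAF

/-- The open unit disk `{z : ℂ | |z| < 1}`, as a set (and, by coercion, as a type). -/
abbrev Disk : Set ℂ := Metric.ball (0 : ℂ) 1

/-- The circle `ℝ / 2πℤ`, that is, `(-π, π]` with its end points glued together. It carries its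
quotient topology and its Borel σ-algebra. -/
abbrev Torus : Type := AddCircle (2 * Real.pi)

/-! ### The space of analytic functions on the disk -/

/-- Extension by zero of a function on the disk to a function on `ℂ`. -/
def extendZero (f : Disk → ℂ) : ℂ → ℂ := Function.extend Subtype.val f 0

theorem extendZero_apply (f : Disk → ℂ) (z : Disk) : extendZero f z = f z :=
  Subtype.val_injective.extend_apply f 0 z

/-- The space of analytic functions on the unit disk. -/
def HolDisk : Type := {f : C(Disk, ℂ) // DifferentiableOn ℂ (extendZero f) Disk}

namespace HolDisk

instance : FunLike HolDisk Disk ℂ where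
  coe f := f.1
  coe_injective _ _ h := Subtype.ext (DFunLike.coe_injective h)

/-- The topology of uniform convergence on compact subsets of the disk (the compact-open topology
inherited from the space of continuous functions). It is the topology of the metric
`∑ j, 2⁻ʲ ‖f - g‖_{K j} / (1 + ‖f - g‖_{K j})` for any exhaustion `K j` of the disk by compact
sets. -/
instance : TopologicalSpace HolDisk :=
  inferInstanceAs (TopologicalSpace {f : C(Disk, ℂ) // DifferentiableOn ℂ (extendZero f) Disk})

instance : MeasurableSpace HolDisk := borel HolDisk

instance : BorelSpace HolDisk := ⟨rfl⟩

/-- The order of vanishing of `f` at `z` (by convention `0` everywhere if `f` is identically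
zero). -/
def zeroMult (f : HolDisk) (z : Disk) : ℕ := analyticOrderNatAt (extendZero f) z

end HolDisk

/-! ### The space of point configurations on the disk -/

/-- An integer-valued Radon measure on the disk: a Borel measure whose value on every Borel set
contained in a compact set is a natural number. -/
def IsPointConfig (μ : Measure Disk) : Prop :=
  ∀ K : Set Disk, IsCompact K → ∀ s ⊆ K, MeasurableSet s → ∃ n : ℕ, μ s = n

/-- The space of locally finite point configurations (with multiplicities) on the disk. -/
def PointConfig : Type := {μ : Measure Disk // IsPointConfig μ}

namespace PointConfig

/-- The vague topology: the coarsest topology for which `μ ↦ ∫ g dμ` is continuous for every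
compactly supported continuous function `g` on the disk. -/
instance : TopologicalSpace PointConfig :=
  ⨅ g : C_c(Disk, ℝ), TopologicalSpace.induced (fun μ : PointConfig => ∫ z, g z ∂μ.1) inferInstance

instance : MeasurableSpace PointConfig := borel PointConfig

instance : BorelSpace PointConfig := ⟨rfl⟩

end PointConfig

/-- The sum `∑ z, (multiplicity of z as a zero of f) δ_z`, as a measure. -/
def zeroMeasure (f : HolDisk) : Measure Disk :=
  Measure.sum fun z : Disk => (f.zeroMult z : ℝ≥0∞) • Measure.dirac z

theorem HolDisk.finite_zeroMult_ne_zero (f : HolDisk) {K : Set Disk} (hK : IsCompact K) :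
    {z ∈ K | f.zeroMult z ≠ 0}.Finite := by
  have hf : AnalyticOnNhd ℂ (extendZero f) Disk :=
    DifferentiableOn.analyticOnNhd f.2 Metric.isOpen_ball
  have h := hf.codiscreteWithin_setOfPred_analyticOrderAt_eq_zero_or_top
  have hK' : IsCompact (Subtype.val '' K : Set ℂ) := hK.image continuous_subtype_val
  have hsub : (Subtype.val '' K : Set ℂ) ⊆ Disk := by
    rintro _ ⟨z, -, rfl⟩
    exact z.2
  have hfin := hK'.finite_sdiff_of_mem_codiscreteWithin (codiscreteWithin_mono hsub h)
  refine Set.Finite.of_finite_image (f := Subtype.val) (hfin.subset ?_)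
    Subtype.val_injective.injOn
  rintro _ ⟨z, ⟨hzK, hz⟩, rfl⟩
  refine ⟨⟨z, hzK, rfl⟩, ?_⟩
  rintro (h0 | h0) <;> exact hz (by simp [HolDisk.zeroMult, analyticOrderNatAt, h0])

theorem isPointConfig_zeroMeasure (f : HolDisk) : IsPointConfig (zeroMeasure f) := by
  classical
  intro K hK s hs hsm
  have hfin := f.finite_zeroMult_ne_zero hK
  refine ⟨∑ z ∈ hfin.toFinset, if z ∈ s then f.zeroMult z else 0, ?_⟩
  rw [zeroMeasure, Measure.sum_apply _ hsm, tsum_eq_sum (s := hfin.toFinset)]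
  · push_cast
    refine Finset.sum_congr rfl fun z _ => ?_
    by_cases hz : z ∈ s <;> simp [Measure.dirac_apply' _ hsm, hz]
  · intro z hz
    by_cases hzs : z ∈ s
    · have : f.zeroMult z = 0 := by
        by_contra hne
        exact hz (by simpa using ⟨hs hzs, hne⟩)
      simp [this]
    · simp [Measure.dirac_apply' _ hsm, hzs]

/-- The zero configuration of an analytic function on the disk: its zeros, counted with
multiplicity. (For the function `0`, where it is not meaningful, it is the empty configuration.) -/
def zeroConfig (f : HolDisk) : PointConfig := ⟨zeroMeasure f, isPointConfig_zeroMeasure f⟩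

/-! ### Gaussian analytic functions -/

/-- `X` is a (centered, complex) Gaussian analytic function on the disk with covariance kernel `K`:
a random element of `HolDisk` whose values form a Gaussian process that is centered and circularly
symmetric, and satisfy `E[X(z) conj X(w)] = K z w`. -/
structure IsGAF {Ω : Type*} [MeasurableSpace Ω] (P : Measure Ω) (X : Ω → HolDisk)
    (K : Disk → Disk → ℂ) : Prop where
  measurable : Measurable X
  /-- The real and imaginary parts of finitely many values of `X` are jointly Gaussian. -/
  gaussian : IsGaussianProcess (fun (z : Disk) (ω : Ω) => X ω z) P
  centered : ∀ z : Disk, ∫ ω, X ω z ∂P = 0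
  /-- The vanishing of `E[X(z) X(w)]` is the circular symmetry of complex Gaussian vectors. -/
  circular : ∀ z w : Disk, ∫ ω, X ω z * X ω w ∂P = 0
  covariance : ∀ z w : Disk, ∫ ω, X ω z * (starRingEnd ℂ) (X ω w) ∂P = K z w

/-- The Szegő kernel `s(z, t) = 1 / (1 - z e^{-it})`. -/
def szego (z : Disk) (t : Torus) : ℂ := 1 / (1 - (z : ℂ) * (AddCircle.toCircle (-t) : ℂ))

/-- On representatives `t : ℝ`, `szego` is given by the formula `1 / (1 - z e^{-it})`. -/
theorem szego_coe (z : Disk) (t : ℝ) :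
    szego z (t : Torus) = 1 / (1 - (z : ℂ) * Complex.exp (-(Complex.I * t))) := by
  have h : (2 * Real.pi / (2 * Real.pi) : ℝ) = 1 := div_self Real.two_pi_pos.ne'
  rw [szego, ← AddCircle.coe_neg, AddCircle.toCircle_apply_mk, h, one_mul, Circle.coe_exp]
  congr 4
  push_cast
  ring

/-- The covariance kernel `K_F(z, w) = ∫ s(z, t) conj s(w, t) F(dt)` of a spectral measure `F`. -/
def spectralKernel (F : ProbabilityMeasure Torus) (z w : Disk) : ℂ :=
  ∫ t, szego z t * (starRingEnd ℂ) (szego w t) ∂(F : Measure Torus)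

end SpectralGAF

end

noncomputable section

namespace SpectralGAF

/-! Since `K_F` is a Gram kernel, `X(z) ↦ s(z, ·)` preserves `L²` norms of linear combinations.
Expanding `s(z, t)` in powers of `z`, the Taylor coefficients `a_k` of `X_F` correspond to
`e^{-ikt}`: they form a stationary circular Gaussian sequence with spectral measure `F`. Hence the
characteristic function of `(a_0, …, a_{m-1})` is `exp (-¼ ∫ |∑ c_k e^{-ikt}|² dF)`, the integral of
a continuous function on a compact space, and weak convergence of `F_n` gives convergence in law of
every finite vector of coefficients (`charFun_map_coeffs`).

The hypotheses only concern values of `X`, so coefficients are reached as limits of normalized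
forward differences at `0` (`norm_evalComb_diffWeight_sub_le`). The bound `E|a_k| ≤ 2`, uniform in
`F` and `k`, makes Taylor polynomials approximate `X` in probability on compact sets, uniformly over
the laws. This lifts convergence of coefficients to convergence in `HolDisk`
(`tendsto_of_tendsto_map_coeffs`).

For the zeros, `zeroConfig` is continuous at every `f` that is not identically zero. This is
Hurwitz's theorem, here drawn from Jensen's formula on two circles: circle averages of `log |g|`
depend continuously on `g` near `f` and determine an integer count. As `X_F(0)` is a nondegenerate
Gaussian, the limit almost surely avoids the zero function and the mapping theorem applies. -/

/-! ### Weak convergence of probability measures -/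

/-- If `f` is Lipschitz with oscillation at most `C`, and `T x` is within `ε` of `x` off a set of
mass at most `ε`, then the integrals of `f` and `f ∘ T` differ by at most `(L + C) * ε`. -/
theorem abs_integral_sub_integral_comp_le {E : Type*} [PseudoMetricSpace E] [MeasurableSpace E]
    [BorelSpace E] {ν : Measure E} [IsProbabilityMeasure ν] {T : E → E} (hT : Continuous T)
    {f : E → ℝ} {C : ℝ} (hC : ∀ x y, dist (f x) (f y) ≤ C) {L : NNReal} (hL : LipschitzWith L f)
    {ε : ℝ} (hε : ν.real {x | ε ≤ dist x (T x)} ≤ ε) (hε0 : 0 ≤ ε) :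
    |∫ x, f x ∂ν - ∫ x, f (T x) ∂ν| ≤ (L + C) * ε := by
  obtain ⟨x₀⟩ : Nonempty E := nonempty_of_isProbabilityMeasure ν
  have hC0 : 0 ≤ C := dist_nonneg.trans (hC x₀ x₀)
  have hfb : ∀ x, ‖f x‖ ≤ ‖f x₀‖ + C := fun x ↦ by
    have := hC x x₀
    rw [Real.dist_eq] at this
    rw [Real.norm_eq_abs, Real.norm_eq_abs]
    linarith [abs_sub_abs_le_abs_sub (f x) (f x₀)]
  have hfm : Continuous f := hL.continuous
  have hi1 : Integrable f ν :=
    Integrable.of_bound hfm.measurable.aestronglyMeasurable _ (ae_of_all _ hfb)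
  have hi2 : Integrable (fun x ↦ f (T x)) ν :=
    Integrable.of_bound (hfm.comp hT).measurable.aestronglyMeasurable _
      (ae_of_all _ fun x ↦ hfb (T x))
  have hS : MeasurableSet {x | ε ≤ dist x (T x)} :=
    (isClosed_le continuous_const (continuous_id.dist hT)).measurableSet
  rw [← integral_sub hi1 hi2]
  -- Lipschitz bound where `T` moves `x` by less than `ε`, oscillation bound on the exceptional set.
  have hpt : ∀ x, |f x - f (T x)| ≤ L * ε + {x | ε ≤ dist x (T x)}.indicator (fun _ ↦ C) x := by
    intro x
    by_cases hx : ε ≤ dist x (T x)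
    · rw [Set.indicator_of_mem (by exact hx)]
      have := hC x (T x)
      rw [Real.dist_eq] at this
      have : 0 ≤ (L : ℝ) * ε := by positivity
      linarith
    · rw [Set.indicator_of_notMem (by exact hx), add_zero, ← Real.dist_eq]
      exact (hL.dist_le_mul x (T x)).trans (by gcongr; exact (not_le.1 hx).le)
  calc |∫ x, (f x - f (T x)) ∂ν| ≤ ∫ x, |f x - f (T x)| ∂ν := abs_integral_le_integral_abs
    _ ≤ ∫ x, (L * ε + {x | ε ≤ dist x (T x)}.indicator (fun _ ↦ C) x) ∂ν :=
        integral_mono (hi1.sub hi2).abs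
          ((integrable_const _).add ((integrable_const C).indicator hS)) hpt
    _ = L * ε + ν.real {x | ε ≤ dist x (T x)} * C := by
        rw [integral_add (integrable_const _) ((integrable_const C).indicator hS),
          integral_indicator_const _ hS]
        simp
    _ ≤ (L + C) * ε := by nlinarith

/-- Weak convergence follows from weak convergence of the images under maps `T m` that approximate
the identity in probability, uniformly over the measures at hand. -/
theorem tendsto_of_forall_tendsto_map {E : Type*} [PseudoMetricSpace E] [MeasurableSpace E]
    [BorelSpace E] {μ : ℕ → ProbabilityMeasure E} {μ₀ : ProbabilityMeasure E}
    {T : ℕ → E → E} (hTc : ∀ m, Continuous (T m))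
    (hT : ∀ m, Tendsto (fun n ↦ (μ n).map (hTc m).aemeasurable) atTop
      (𝓝 (μ₀.map (hTc m).aemeasurable)))
    (happ : ∀ ε > 0, ∃ m, (μ₀ : Measure E).real {x | ε ≤ dist x (T m x)} ≤ ε ∧
      ∀ n, (μ n : Measure E).real {x | ε ≤ dist x (T m x)} ≤ ε) :
    Tendsto μ atTop (𝓝 μ₀) := by
  rw [tendsto_iff_forall_lipschitz_integral_tendsto]
  rintro f ⟨C, hC⟩ ⟨L, hL⟩
  obtain ⟨x₀⟩ : Nonempty E := nonempty_of_isProbabilityMeasure (μ₀ : Measure E)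
  have hC0 : 0 ≤ C := dist_nonneg.trans (hC x₀ x₀)
  rw [Metric.tendsto_nhds]
  intro δ hδ
  obtain ⟨ε, hε, hεδ⟩ : ∃ ε > 0, (L + C) * ε < δ / 3 := by
    refine ⟨δ / (6 * (L + C + 1)), by positivity, ?_⟩
    rw [mul_div_assoc', div_lt_div_iff₀ (by positivity) (by positivity)]
    have : 0 ≤ (L : ℝ) := L.2
    nlinarith
  obtain ⟨m, hm0, hm⟩ := happ ε hε
  have h1 := (tendsto_iff_forall_lipschitz_integral_tendsto.1 (hT m)) f ⟨C, hC⟩ ⟨L, hL⟩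
  have hmap : ∀ ν : ProbabilityMeasure E,
      ∫ x, f x ∂(ν.map (hTc m).aemeasurable : ProbabilityMeasure E) =
        ∫ x, f (T m x) ∂(ν : Measure E) := fun ν ↦ by
    rw [ProbabilityMeasure.toMeasure_map]
    exact integral_map (hTc m).aemeasurable hL.continuous.measurable.aestronglyMeasurable
  simp only [hmap] at h1
  filter_upwards [Metric.tendsto_nhds.1 h1 (δ / 3) (by positivity)] with n hn
  have e1 := abs_integral_sub_integral_comp_le (hTc m) hC hL (hm n) hε.le
  have e0 := abs_integral_sub_integral_comp_le (hTc m) hC hL hm0 hε.le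
  rw [Real.dist_eq] at hn ⊢
  rw [abs_lt] at hn ⊢
  rw [abs_le] at e0 e1
  constructor <;> linarith

/-- The mapping theorem, for maps that are continuous on an open set of full limit measure. -/
theorem tendsto_map_of_continuousOn {E F : Type*} [TopologicalSpace E] [MeasurableSpace E]
    [OpensMeasurableSpace E] [HasOuterApproxClosed E] [TopologicalSpace F] [MeasurableSpace F]
    [OpensMeasurableSpace F] {μ : ℕ → ProbabilityMeasure E} {μ₀ : ProbabilityMeasure E}
    (hμ : Tendsto μ atTop (𝓝 μ₀)) {g : E → F} (hg : Measurable g) {U : Set E} (hU : IsOpen U)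
    (hgU : ContinuousOn g U) (h0 : (μ₀ : Measure E) Uᶜ = 0) :
    Tendsto (fun n ↦ (μ n).map hg.aemeasurable) atTop (𝓝 (μ₀.map hg.aemeasurable)) := by
  refine tendsto_of_forall_isOpen_le_liminf' fun G hG ↦ ?_
  simp only [ProbabilityMeasure.toMeasure_map]
  rw [Measure.map_apply hg hG.measurableSet]
  -- `g ⁻¹' G` itself need not be open. Its trace on `U` is, and has the same limit measure, so the
  -- portmanteau inequality is applied to the trace.
  have hopen : IsOpen (U ∩ g ⁻¹' G) := hgU.isOpen_inter_preimage hU hG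
  calc (μ₀ : Measure E) (g ⁻¹' G) ≤ (μ₀ : Measure E) (U ∩ g ⁻¹' G) + (μ₀ : Measure E) Uᶜ := by
        refine (measure_mono fun x hx ↦ ?_).trans (measure_union_le _ _)
        by_cases hxU : x ∈ U
        · exact Or.inl ⟨hxU, hx⟩
        · exact Or.inr hxU
    _ = (μ₀ : Measure E) (U ∩ g ⁻¹' G) := by rw [h0, add_zero]
    _ ≤ liminf (fun n ↦ (μ n : Measure E) (U ∩ g ⁻¹' G)) atTop :=
        ProbabilityMeasure.le_liminf_measure_open_of_tendsto hμ hopen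
    _ ≤ _ := by
        refine liminf_le_liminf (Eventually.of_forall fun n ↦ ?_)
        rw [Measure.map_apply hg hG.measurableSet]
        exact measure_mono Set.inter_subset_right

/-! ### Finite linear combinations of values -/

/-- The finite linear combination `∑ z, w z * f z` of values of `f`. -/
def evalComb (w : Disk →₀ ℂ) (f : Disk → ℂ) : ℂ := Finsupp.linearCombination ℂ f w

theorem evalComb_eq_sum (w : Disk →₀ ℂ) (f : Disk → ℂ) :
    evalComb w f = ∑ z ∈ w.support, w z * f z := by
  simp [evalComb, Finsupp.linearCombination_apply, Finsupp.sum]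

theorem memLp_evalComb {α : Type*} [MeasurableSpace α] {ν : Measure α} {Y : α → Disk → ℂ}
    (hY : ∀ z, MemLp (fun a ↦ Y a z) 2 ν) (w : Disk →₀ ℂ) :
    MemLp (fun a ↦ evalComb w (Y a)) 2 ν := by
  simp only [evalComb_eq_sum]
  exact memLp_finsetSum _ fun z _ ↦ (hY z).const_mul (w z)

/-- Bilinear rather than sesquilinear: `Y' = Y` yields the pseudo-covariance, while `Y' = conj Y`
combined with `conj_evalComb` yields the covariance. -/
theorem integral_evalComb_mul_evalComb {α : Type*} [MeasurableSpace α] {ν : Measure α}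
    {Y Y' : α → Disk → ℂ} (hY : ∀ z, MemLp (fun a ↦ Y a z) 2 ν)
    (hY' : ∀ z, MemLp (fun a ↦ Y' a z) 2 ν) (w w' : Disk →₀ ℂ) :
    ∫ a, evalComb w (Y a) * evalComb w' (Y' a) ∂ν =
      ∑ z ∈ w.support, ∑ z' ∈ w'.support, w z * w' z' * ∫ a, Y a z * Y' a z' ∂ν := by
  have hi : ∀ z z', Integrable (fun a ↦ w z * Y a z * (w' z' * Y' a z')) ν := fun z z' ↦
    ((hY z).const_mul (w z)).integrable_mul ((hY' z').const_mul (w' z'))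
  simp only [evalComb_eq_sum, Finset.sum_mul_sum]
  rw [integral_finsetSum _ fun z _ ↦ integrable_finsetSum _ fun z' _ ↦ hi z z']
  refine Finset.sum_congr rfl fun z _ ↦ ?_
  rw [integral_finsetSum _ fun z' _ ↦ hi z z']
  refine Finset.sum_congr rfl fun z' _ ↦ ?_
  rw [← integral_const_mul]
  congr 1 with a
  ring

theorem conj_evalComb (w : Disk →₀ ℂ) (f : Disk → ℂ) :
    (starRingEnd ℂ) (evalComb w f) =
      evalComb (w.mapRange (starRingEnd ℂ) (map_zero _)) fun z ↦ (starRingEnd ℂ) (f z) := by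
  simp only [evalComb, Finsupp.linearCombination_apply, Finsupp.sum_mapRange_index
    (h := fun z a ↦ a • (starRingEnd ℂ) (f z)) (fun _ ↦ zero_smul _ _)]
  simp [Finsupp.sum]

/-! ### The Szegő kernel -/

theorem norm_toCircle_neg (t : Torus) : ‖(AddCircle.toCircle (-t) : ℂ)‖ = 1 :=
  Circle.norm_coe _

theorem norm_mul_toCircle_neg (z : Disk) (t : Torus) :
    ‖(z : ℂ) * (AddCircle.toCircle (-t) : ℂ)‖ < 1 := by
  rw [norm_mul, norm_toCircle_neg, mul_one]
  exact mem_ball_zero_iff.1 z.2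

theorem one_sub_mul_toCircle_neg_ne_zero (z : Disk) (t : Torus) :
    1 - (z : ℂ) * (AddCircle.toCircle (-t) : ℂ) ≠ 0 := by
  intro h
  have := norm_mul_toCircle_neg z t
  rw [← sub_eq_zero.1 h, norm_one] at this
  exact lt_irrefl _ this

theorem continuous_szego (z : Disk) : Continuous (szego z) := by
  unfold szego
  refine continuous_const.div ?_ (one_sub_mul_toCircle_neg_ne_zero z)
  exact continuous_const.sub (continuous_const.mul
    (continuous_subtype_val.comp (AddCircle.continuous_toCircle.comp continuous_neg)))

instance : CompactSpace Torus :=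
  haveI : Fact (0 < 2 * Real.pi) := ⟨Real.two_pi_pos⟩
  inferInstanceAs (CompactSpace (AddCircle (2 * Real.pi)))

theorem memLp_of_continuous {ν : Measure Torus} [IsFiniteMeasure ν] {f : Torus → ℂ}
    (hf : Continuous f) (p : ℝ≥0∞) : MemLp f p ν := by
  obtain ⟨C, hC⟩ := isCompact_univ.exists_bound_of_continuousOn hf.continuousOn
  exact MemLp.of_bound hf.aestronglyMeasurable C (ae_of_all _ fun t ↦ hC t (Set.mem_univ t))

theorem continuous_evalComb_szego (w : Disk →₀ ℂ) :
    Continuous fun t ↦ evalComb w (szego · t) := by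
  simp only [evalComb_eq_sum]
  exact continuous_finsetSum _ fun z _ ↦ continuous_const.mul (continuous_szego z)

/-! ### Linear combinations of values of a Gaussian analytic function -/

namespace IsGAF

variable {Ω : Type*} [MeasurableSpace Ω] {P : Measure Ω} {X : Ω → HolDisk}

section

variable {K : Disk → Disk → ℂ}

theorem memLp_eval (h : IsGAF P X K) (z : Disk) : MemLp (fun ω ↦ X ω z) 2 P :=
  (h.gaussian.hasGaussianLaw_eval z).memLp_two

theorem hasGaussianLaw_evalComb (h : IsGAF P X K) (w : Disk →₀ ℂ) :
    HasGaussianLaw (fun ω ↦ evalComb w (X ω)) P := by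
  let L : (w.support → ℂ) →L[ℝ] ℂ :=
    ∑ i : w.support, (ContinuousLinearMap.mul ℝ ℂ (w i)).comp (ContinuousLinearMap.proj i)
  have hL : (fun ω ↦ evalComb w (X ω)) = fun ω ↦ L (w.support.restrict (X ω)) := by
    funext ω
    rw [evalComb_eq_sum, ← Finset.sum_coe_sort]
    simp [L]
  rw [hL]
  exact (h.gaussian.hasGaussianLaw w.support).map_fun L

theorem integral_evalComb (h : IsGAF P X K) (w : Disk →₀ ℂ) :
    ∫ ω, evalComb w (X ω) ∂P = 0 := by
  have : IsProbabilityMeasure P := h.gaussian.isProbabilityMeasure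
  simp only [evalComb_eq_sum]
  rw [integral_finsetSum _ fun z _ ↦ ((h.memLp_eval z).integrable one_le_two).const_mul _]
  simp [integral_const_mul, h.centered]

theorem integral_evalComb_mul_self (h : IsGAF P X K) (w : Disk →₀ ℂ) :
    ∫ ω, evalComb w (X ω) * evalComb w (X ω) ∂P = 0 := by
  rw [integral_evalComb_mul_evalComb h.memLp_eval h.memLp_eval]
  simp [h.circular]

end

variable {F : ProbabilityMeasure Torus}

/-- Both sides expand to the same double sum, because the kernel is the Gram kernel of the functions
`szego z` in `L²(F)`. -/
theorem integral_evalComb_mul_conj (h : IsGAF P X (spectralKernel F)) (w : Disk →₀ ℂ) :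
    ∫ ω, evalComb w (X ω) * (starRingEnd ℂ) (evalComb w (X ω)) ∂P =
      ∫ t, evalComb w (szego · t) * (starRingEnd ℂ) (evalComb w (szego · t))
        ∂(F : Measure Torus) := by
  have hs : ∀ z, MemLp (fun t ↦ szego z t) 2 (F : Measure Torus) := fun z ↦
    memLp_of_continuous (continuous_szego z) 2
  simp only [conj_evalComb]
  rw [integral_evalComb_mul_evalComb (Y' := fun ω z ↦ (starRingEnd ℂ) (X ω z)) h.memLp_eval
      fun z ↦ (h.memLp_eval z).star,
    integral_evalComb_mul_evalComb (Y := fun t z ↦ szego z t)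
      (Y' := fun t z ↦ (starRingEnd ℂ) (szego z t)) hs fun z ↦ (hs z).star]
  simp only [h.covariance, spectralKernel]

theorem integral_normSq_evalComb (h : IsGAF P X (spectralKernel F)) (w : Disk →₀ ℂ) :
    ∫ ω, ‖evalComb w (X ω)‖ ^ 2 ∂P = ∫ t, ‖evalComb w (szego · t)‖ ^ 2 ∂(F : Measure Torus) := by
  have := h.integral_evalComb_mul_conj w
  simp only [Complex.mul_conj, Complex.normSq_eq_norm_sq] at this
  rw [integral_complex_ofReal, integral_complex_ofReal] at this
  exact_mod_cast this

theorem lintegral_enormSq_evalComb (h : IsGAF P X (spectralKernel F)) (w : Disk →₀ ℂ) :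
    ∫⁻ ω, ‖evalComb w (X ω)‖ₑ ^ 2 ∂P =
      ENNReal.ofReal (∫ t, ‖evalComb w (szego · t)‖ ^ 2 ∂(F : Measure Torus)) := by
  rw [← h.integral_normSq_evalComb, ofReal_integral_eq_lintegral_ofReal
    ((memLp_evalComb h.memLp_eval w).integrable_norm_pow two_ne_zero)
    (ae_of_all _ fun ω ↦ by positivity)]
  congr 1 with ω
  rw [ENNReal.ofReal_pow (norm_nonneg _), ofReal_norm]

theorem integral_re_evalComb (h : IsGAF P X (spectralKernel F)) (w : Disk →₀ ℂ) :
    ∫ ω, (evalComb w (X ω)).re ∂P = 0 := by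
  have : IsProbabilityMeasure P := h.gaussian.isProbabilityMeasure
  have := integral_re ((memLp_evalComb h.memLp_eval w).integrable one_le_two)
  rw [h.integral_evalComb w] at this
  simpa using this

/-- `(Re Y)² = (|Y|² + Re Y²) / 2`, and circular symmetry kills the mean of `Y²`. -/
theorem variance_re_evalComb (h : IsGAF P X (spectralKernel F)) (w : Disk →₀ ℂ) :
    Var[fun ω ↦ (evalComb w (X ω)).re; P] =
      (∫ t, ‖evalComb w (szego · t)‖ ^ 2 ∂(F : Measure Torus)) / 2 := by
  have : IsProbabilityMeasure P := h.gaussian.isProbabilityMeasure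
  have hL := memLp_evalComb h.memLp_eval w
  have h0 := h.integral_re_evalComb w
  have hsq : ∫ ω, (evalComb w (X ω) * evalComb w (X ω)).re ∂P = 0 := by
    have := integral_re (hL.integrable_mul hL)
    simp only [RCLike.re_eq_complex_re, Pi.mul_apply] at this ⊢
    simpa [h.integral_evalComb_mul_self w] using this
  have hsqi : Integrable (fun ω ↦ (evalComb w (X ω) * evalComb w (X ω)).re) P :=
    (hL.integrable_mul hL).re
  have hm : AEMeasurable (fun ω ↦ (evalComb w (X ω)).re) P :=
    hL.re.aestronglyMeasurable.aemeasurable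
  rw [variance_of_integral_eq_zero hm h0,
    ← h.integral_normSq_evalComb]
  have : ∀ ω, (evalComb w (X ω)).re ^ 2 =
      (‖evalComb w (X ω)‖ ^ 2 + (evalComb w (X ω) * evalComb w (X ω)).re) / 2 := fun ω ↦ by
    rw [← Complex.normSq_eq_norm_sq, Complex.normSq_apply, Complex.mul_re]
    ring
  simp only [this]
  rw [integral_div, integral_add (hL.integrable_norm_pow two_ne_zero) hsqi, hsq, add_zero]

theorem hasGaussianLaw_re_evalComb (h : IsGAF P X (spectralKernel F)) (w : Disk →₀ ℂ) :
    HasGaussianLaw (fun ω ↦ (evalComb w (X ω)).re) P :=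
  (h.hasGaussianLaw_evalComb w).map_fun Complex.reCLM

theorem map_re_evalComb (h : IsGAF P X (spectralKernel F)) (w : Disk →₀ ℂ) :
    P.map (fun ω ↦ (evalComb w (X ω)).re) = gaussianReal 0
      ((∫ t, ‖evalComb w (szego · t)‖ ^ 2 ∂(F : Measure Torus)) / 2).toNNReal := by
  have : IsProbabilityMeasure P := h.gaussian.isProbabilityMeasure
  rw [(h.hasGaussianLaw_re_evalComb w).map_eq_gaussianReal, h.variance_re_evalComb, h.integral_re_evalComb]

/-- Evaluation at the frequency `1` suffices, since the weights `w` are arbitrary. The `4` is the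
`2` of the Gaussian exponent times the `2` of the variance. -/
theorem integral_exp_re_evalComb (h : IsGAF P X (spectralKernel F)) (w : Disk →₀ ℂ) :
    ∫ ω, Complex.exp ((evalComb w (X ω)).re * Complex.I) ∂P =
      Complex.exp (-((∫ t, ‖evalComb w (szego · t)‖ ^ 2 ∂(F : Measure Torus) : ℝ) : ℂ) / 4) := by
  have h1 := charFun_gaussianReal (μ := 0)
    (v := ((∫ t, ‖evalComb w (szego · t)‖ ^ 2 ∂(F : Measure Torus)) / 2).toNNReal) 1
  rw [← h.map_re_evalComb, charFun_apply_real,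
    integral_map (h.hasGaussianLaw_re_evalComb w).aemeasurable (by fun_prop)] at h1
  simp only [Complex.ofReal_one, one_mul] at h1
  rw [h1]
  congr 1
  rw [Real.coe_toNNReal _ (by positivity)]
  push_cast
  ring

/-- A Gaussian analytic function with spectral measure does almost surely not vanish at `0`. -/
theorem ae_ne_zero (h : IsGAF P X (spectralKernel F)) : ∀ᵐ ω ∂P, X ω ⟨0, by simp⟩ ≠ 0 := by
  set z₀ : Disk := ⟨0, by simp⟩
  have hw : ∀ f : Disk → ℂ, evalComb (Finsupp.single z₀ 1) f = f z₀ := fun f ↦ by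
    simp [evalComb]
  have h1 := h.map_re_evalComb (Finsupp.single z₀ 1)
  simp only [hw] at h1
  -- Hence `Re X(0)` has law `N(0, 1/2)`, which has no atoms.
  have hs : ∀ t, szego z₀ t = 1 := fun t ↦ by simp [szego, z₀]
  simp only [hs, norm_one, one_pow, integral_const, probReal_univ, smul_eq_mul, mul_one] at h1
  have := nullSingletonClass_gaussianReal (μ := 0) (v := (1 / 2 : ℝ).toNNReal) (by simp)
  have h2 : P.map (fun ω ↦ (X ω z₀).re) {0} = 0 := by rw [h1]; exact measure_singleton 0
  have hm : AEMeasurable (fun ω ↦ (X ω z₀).re) P := by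
    simpa only [hw] using (h.hasGaussianLaw_re_evalComb (Finsupp.single z₀ 1)).aemeasurable
  rw [Measure.map_apply_of_aemeasurable hm (measurableSet_singleton 0)] at h2
  refine measure_mono_null (fun ω hω ↦ ?_) h2
  have : X ω z₀ = 0 := by simpa using hω
  simp [this]

end IsGAF

namespace HolDisk

/-! ### The topology of the space of analytic functions -/

instance : SigmaCompactSpace Disk :=
  haveI : LocallyCompactSpace Disk := Metric.isOpen_ball.locallyCompactSpace
  inferInstance

instance : UniformSpace HolDisk :=
  inferInstanceAs (UniformSpace {f : C(Disk, ℂ) // DifferentiableOn ℂ (extendZero f) Disk})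

/-- Makes `HolDisk` pseudo-metrizable, as the weak convergence criteria require, and its
neighbourhood filters countably generated, as dominated convergence along `𝓝 f` requires. -/
instance : (uniformity HolDisk).IsCountablyGenerated :=
  haveI : LocallyCompactSpace Disk := Metric.isOpen_ball.locallyCompactSpace
  inferInstanceAs (IsCountablyGenerated
    (comap (fun q : HolDisk × HolDisk ↦ (q.1.1, q.2.1)) (uniformity C(Disk, ℂ))))

instance : T2Space HolDisk :=
  inferInstanceAs (T2Space {f : C(Disk, ℂ) // DifferentiableOn ℂ (extendZero f) Disk})

theorem continuous_val : Continuous fun f : HolDisk ↦ (f.1 : C(Disk, ℂ)) :=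
  continuous_subtype_val

theorem tendstoUniformlyOn_nhds (f : HolDisk) {K : Set Disk} (hK : IsCompact K) :
    TendstoUniformlyOn (fun (g : HolDisk) z ↦ g z) f (𝓝 f) K :=
  ContinuousMap.tendsto_iff_forall_isCompact_tendstoUniformlyOn.1 (continuous_val.tendsto f) K hK

theorem eventually_forall_dist_lt (f : HolDisk) {K : Set Disk} (hK : IsCompact K) {ε : ℝ}
    (hε : 0 < ε) : ∀ᶠ g : HolDisk in 𝓝 f, ∀ z ∈ K, ‖f z - g z‖ < ε := by
  filter_upwards [Metric.tendstoUniformlyOn_iff.1 (f.tendstoUniformlyOn_nhds hK) ε hε] with g hg z hz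
  rw [← dist_eq_norm]
  exact hg z hz

/-- Uniform closeness on a compact set controls any entourage of the space of analytic
functions. -/
theorem exists_isCompact_forall_mem {V : Set (HolDisk × HolDisk)} (hV : V ∈ uniformity HolDisk) :
    ∃ K : Set Disk, IsCompact K ∧ ∃ ε > 0, ∀ f g : HolDisk,
      (∀ z ∈ K, ‖f z - g z‖ < ε) → (f, g) ∈ V := by
  have hb : (uniformity HolDisk).HasBasis
      (fun p : Set Disk × ℝ ↦ IsCompact p.1 ∧ 0 < p.2) fun p ↦
        (fun q : HolDisk × HolDisk ↦ (q.1.1, q.2.1)) ⁻¹'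
          {fg : C(Disk, ℂ) × C(Disk, ℂ) | ∀ z ∈ p.1,
            (fg.1 z, fg.2 z) ∈ {q : ℂ × ℂ | dist q.1 q.2 < p.2}} :=
    (Metric.uniformity_basis_dist.compactConvergenceUniformity (α := Disk)).comap _
  obtain ⟨⟨K, ε⟩, ⟨hK, hε⟩, h⟩ := hb.mem_iff.1 hV
  refine ⟨K, hK, ε, hε, fun f g hfg ↦ h fun z hz ↦ ?_⟩
  have := hfg z hz
  rwa [← dist_eq_norm] at this

theorem extendZero_of_mem (f : HolDisk) {z : ℂ} (hz : z ∈ Disk) : extendZero f z = f ⟨z, hz⟩ :=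
  extendZero_apply f ⟨z, hz⟩

/-- The analytic function on the disk given by a function that is differentiable there. -/
def ofDifferentiableOn (g : ℂ → ℂ) (hg : DifferentiableOn ℂ g Disk) : HolDisk :=
  ⟨⟨fun z ↦ g z, hg.continuousOn.domRestrict⟩, hg.congr fun z hz ↦
    extendZero_apply (fun z : Disk ↦ g z) ⟨z, hz⟩⟩

/-! ### Taylor coefficients -/

/-- The `k`-th Taylor coefficient at the origin. -/
def coeff (k : ℕ) (f : HolDisk) : ℂ := iteratedDeriv k (extendZero f) 0 / k.factorial

theorem hasSum_coeff (f : HolDisk) (z : Disk) : HasSum (fun k ↦ coeff k f * (z : ℂ) ^ k) (f z) := by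
  have h := Complex.hasSum_taylorSeries_on_ball f.2 z.2
  have e : extendZero f.1 z = f z := extendZero_apply f z
  rw [e] at h
  refine h.congr_fun fun k ↦ ?_
  change iteratedDeriv k (extendZero f) 0 / k.factorial * (z : ℂ) ^ k =
    (k.factorial : ℂ)⁻¹ * (((z : ℂ) - 0) ^ k * iteratedDeriv k (extendZero f) 0)
  ring

/-- Cauchy's estimate on the circle of radius `1 / 2`, a compact subset of the disk. Continuity of
the coefficients follows. -/
theorem norm_coeff_sub_le (k : ℕ) {f g : HolDisk} {C : ℝ}
    (h : ∀ z : Disk, ‖(z : ℂ)‖ = 1 / 2 → ‖f z - g z‖ ≤ C) :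
    ‖coeff k f - coeff k g‖ ≤ C * 2 ^ k := by
  have hsub : Metric.closedBall (0 : ℂ) (1 / 2) ⊆ Disk :=
    Metric.closedBall_subset_ball (by norm_num)
  have hd : DifferentiableOn ℂ (extendZero f - extendZero g) Disk := f.2.sub g.2
  have hc : ∀ F : HolDisk, ContDiffAt ℂ k (extendZero F) 0 := fun F ↦
    (F.2.analyticAt (Metric.ball_mem_nhds 0 one_pos)).contDiffAt
  have key := Complex.norm_iteratedDeriv_le_of_forall_mem_sphere_norm_le (C := C) k
    (by norm_num : (0 : ℝ) < 1 / 2) ((hd.mono hsub).diffContOnCl_ball subset_rfl) fun z hz ↦ by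
      have hz' : z ∈ Disk := hsub (Metric.sphere_subset_closedBall hz)
      rw [Pi.sub_apply, f.extendZero_of_mem hz', g.extendZero_of_mem hz']
      exact h ⟨z, hz'⟩ (mem_sphere_zero_iff_norm.1 hz)
  rw [iteratedDeriv_sub (hc f) (hc g)] at key
  rw [coeff, coeff, ← sub_div, norm_div, Complex.norm_natCast, div_le_iff₀ (by positivity)]
  refine key.trans (le_of_eq ?_)
  rw [one_div, inv_pow, div_inv_eq_mul]
  ring

theorem continuous_coeff (k : ℕ) : Continuous (coeff k) := by
  rw [continuous_iff_continuousAt]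
  intro f
  have hK : IsCompact {z : Disk | ‖(z : ℂ)‖ = 1 / 2} := by
    rw [Subtype.isCompact_iff]
    convert isCompact_sphere (0 : ℂ) (1 / 2) using 1
    ext z
    simp only [Set.mem_image, Set.mem_ofPred_eq, Subtype.exists, mem_sphere_zero_iff_norm]
    constructor
    · rintro ⟨w, _, hw, rfl⟩
      exact hw
    · intro hz
      exact ⟨z, mem_ball_zero_iff.2 (by rw [hz]; norm_num), hz, rfl⟩
  refine Metric.tendsto_nhds.2 fun ε hε ↦ ?_
  filter_upwards [f.eventually_forall_dist_lt hK (ε := ε / (2 * 2 ^ k)) (by positivity)] with g hg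
  rw [dist_comm, dist_eq_norm]
  refine (norm_coeff_sub_le k fun z hz ↦ (hg z hz).le).trans_lt ?_
  field_simp
  linarith

/-- Cauchy's estimate on the circle of radius `3 / 4`. -/
theorem exists_norm_coeff_le (f : HolDisk) : ∃ B, ∀ k, ‖coeff k f‖ ≤ B * (4 / 3) ^ k := by
  have h := (f.hasSum_coeff ⟨3 / 4, by simp; norm_num⟩).summable.tendsto_atTop_zero.norm
  obtain ⟨B, hB⟩ := h.bddAbove_range
  refine ⟨B, fun k ↦ ?_⟩
  have := hB (Set.mem_range_self k)
  simp only [norm_mul, norm_pow] at this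
  have e : ‖(3 / 4 : ℂ)‖ = 3 / 4 := by simp
  rw [e] at this
  calc ‖coeff k f‖ = ‖coeff k f‖ * (3 / 4) ^ k * (4 / 3) ^ k := by
        rw [mul_assoc, ← mul_pow]; norm_num
    _ ≤ _ := by gcongr

/-- The polynomial with the given coefficients. -/
def ofCoeffs {m : ℕ} (c : EuclideanSpace ℂ (Fin m)) : HolDisk :=
  ofDifferentiableOn (fun z ↦ ∑ k, c k * z ^ (k : ℕ)) (by fun_prop)

theorem continuous_ofCoeffs (m : ℕ) : Continuous (ofCoeffs (m := m)) := by
  refine Continuous.subtype_mk (f := fun c ↦ (ofCoeffs c).1) ?_ _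
  have : (fun c : EuclideanSpace ℂ (Fin m) ↦ (ofCoeffs c).1) = fun c ↦
      ∑ k : Fin m, c k • (⟨fun z ↦ (z : ℂ) ^ (k : ℕ), by fun_prop⟩ : C(Disk, ℂ)) := by
    ext c z
    rw [ContinuousMap.sum_apply]
    rfl
  rw [this]
  fun_prop

/-- The first `m` Taylor coefficients at the origin. -/
def coeffs (m : ℕ) (f : HolDisk) : EuclideanSpace ℂ (Fin m) := WithLp.toLp 2 fun k ↦ coeff k f

theorem continuous_coeffs (m : ℕ) : Continuous (coeffs m) :=
  (PiLp.continuous_toLp 2 _).comp (continuous_pi fun k ↦ continuous_coeff k)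

/-- The Taylor polynomial of degree less than `m` at the origin. -/
def taylor (m : ℕ) (f : HolDisk) : HolDisk := ofCoeffs (coeffs m f)

theorem continuous_taylor (m : ℕ) : Continuous (taylor m) :=
  (continuous_ofCoeffs m).comp (continuous_coeffs m)

theorem taylor_apply (m : ℕ) (f : HolDisk) (z : Disk) :
    taylor m f z = ∑ k ∈ Finset.range m, coeff k f * (z : ℂ) ^ k := by
  rw [Finset.sum_range]
  rfl

end HolDisk

/-! ### Taylor coefficients as limits of finite differences -/

open Classical in
/-- The point of the disk with the given value (by convention `0` if there is none). -/
def diskPt (x : ℂ) : Disk := if h : x ∈ Disk then ⟨x, h⟩ else ⟨0, by simp⟩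

theorem coe_diskPt {x : ℂ} (hx : ‖x‖ < 1) : (diskPt x : ℂ) = x := by
  rw [diskPt, dif_pos (mem_ball_zero_iff.2 hx)]

/-- The weights of the normalized `k`-th forward difference at `0` with step `h`. -/
def diffWeight (k : ℕ) (h : ℝ) : Disk →₀ ℂ :=
  ((k.factorial : ℂ) * h ^ k)⁻¹ • ∑ j ∈ Finset.range (k + 1),
    Finsupp.single (diskPt (j * h)) ((-1) ^ (k - j) * k.choose j : ℂ)

theorem evalComb_diffWeight (k : ℕ) (h : ℝ) (f : Disk → ℂ) :
    evalComb (diffWeight k h) f = ((k.factorial : ℂ) * h ^ k)⁻¹ *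
      ∑ j ∈ Finset.range (k + 1), (-1) ^ (k - j) * k.choose j * f (diskPt (j * h)) := by
  simp only [evalComb, diffWeight, map_smul, map_sum, Finsupp.linearCombination_single, smul_eq_mul]

/-- The `k`-th forward difference annihilates monomials of degree below `k` and sends `x ^ k` to
`k!`. -/
theorem sum_choose_mul_pow (k i : ℕ) (hi : i ≤ k) :
    ∑ j ∈ Finset.range (k + 1), (-1) ^ (k - j) * (k.choose j : ℂ) * (j : ℂ) ^ i =
      if i = k then (k.factorial : ℂ) else 0 := by
  have h := fwdDiff_iter_eq_sum_shift (1 : ℂ) (fun r : ℂ ↦ r ^ i) k 0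
  have e : ∑ j ∈ Finset.range (k + 1), (-1) ^ (k - j) * (k.choose j : ℂ) * (j : ℂ) ^ i =
      (fwdDiff (1 : ℂ))^[k] (fun r : ℂ ↦ r ^ i) 0 := by
    rw [h]
    refine Finset.sum_congr rfl fun j _ ↦ ?_
    simp
  rw [e]
  split_ifs with hik
  · subst hik
    rw [fwdDiff_iter_eq_factorial]
    simp
  · rw [fwdDiff_iter_pow_eq_zero_of_lt (lt_of_le_of_ne hi hik)]
    rfl

/-- A constant in the error of the normalized forward difference. -/
def diffConst (k : ℕ) : ℝ :=
  (k.factorial : ℝ)⁻¹ * ∑ j ∈ Finset.range (k + 1), k.choose j * (3 * (4 / 3 * j) ^ (k + 1) : ℝ)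

theorem diffConst_nonneg (k : ℕ) : 0 ≤ diffConst k := by unfold diffConst; positivity

/-- The Taylor polynomial of degree `k` contributes exactly `a k`, and the remainder is `O(h ^ (k +
1))` before division by `h ^ k`. The error depends on `f` only through `B`, so the bound serves both
the sample functions and, uniformly in `t`, the functions `szego · t`. -/
theorem norm_evalComb_diffWeight_sub_le {f : Disk → ℂ} {a : ℕ → ℂ} {B : ℝ}
    (hf : ∀ z : Disk, HasSum (fun n ↦ a n * (z : ℂ) ^ n) (f z))
    (ha : ∀ n, ‖a n‖ ≤ B * (4 / 3) ^ n) (k : ℕ) {h : ℝ} (h0 : 0 < h) (hk : k * h ≤ 1 / 2) :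
    ‖evalComb (diffWeight k h) f - a k‖ ≤ diffConst k * B * h := by
  have hB : 0 ≤ B := by simpa using (norm_nonneg _).trans (ha 0)
  set R : ℕ → ℂ := fun j ↦ f (diskPt (j * h)) - ∑ i ∈ Finset.range (k + 1), a i * (j * h : ℂ) ^ i
    with hR
  have hjh : ∀ j ∈ Finset.range (k + 1), ‖(j * h : ℂ)‖ = j * h ∧ (j * h : ℝ) ≤ 1 / 2 := by
    intro j hj
    refine ⟨by simp [abs_of_pos h0], le_trans ?_ hk⟩
    have : (j : ℝ) ≤ k := by exact_mod_cast Nat.lt_succ_iff.1 (Finset.mem_range.1 hj)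
    gcongr
  have hRb : ∀ j ∈ Finset.range (k + 1), ‖R j‖ ≤ B * (3 * (4 / 3 * j) ^ (k + 1)) * h ^ (k + 1) := by
    intro j hj
    obtain ⟨h1, h2⟩ := hjh j hj
    have hz : (diskPt (j * h) : ℂ) = j * h := coe_diskPt (by rw [h1]; linarith)
    have hsum := hf (diskPt (j * h))
    rw [hz] at hsum
    have hgeo := norm_sub_le_of_geometric_bound_of_hasSum (r := 4 / 3 * (j * h)) (C := B)
      (by linarith) (fun n ↦ ?_) hsum (k + 1)
    · rw [norm_sub_rev] at hgeo
      refine hgeo.trans ?_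
      rw [div_le_iff₀ (by linarith)]
      -- The nodes satisfy `j * h ≤ 1 / 2`, so the geometric ratio is at most `2 / 3` and its series
      -- costs a factor `3`.
      have h3 : (1 : ℝ) ≤ 3 * (1 - 4 / 3 * (j * h)) := by linarith
      calc B * (4 / 3 * (j * h)) ^ (k + 1)
          = B * (4 / 3 * j) ^ (k + 1) * h ^ (k + 1) * 1 := by
            rw [← mul_assoc (4 / 3 : ℝ), mul_pow]; ring
        _ ≤ B * (4 / 3 * j) ^ (k + 1) * h ^ (k + 1) * (3 * (1 - 4 / 3 * (j * h))) := by gcongr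
        _ = _ := by ring
    · rw [norm_mul, norm_pow, h1, mul_pow (4 / 3 : ℝ), ← mul_assoc]
      exact mul_le_mul_of_nonneg_right (ha n) (by positivity)
  have hmain : evalComb (diffWeight k h) f - a k = ((k.factorial : ℂ) * h ^ k)⁻¹ *
      ∑ j ∈ Finset.range (k + 1), (-1) ^ (k - j) * k.choose j * R j := by
    have h0' : (h : ℂ) ≠ 0 := by exact_mod_cast h0.ne'
    have hpoly : ∑ j ∈ Finset.range (k + 1), (-1) ^ (k - j) * (k.choose j : ℂ) *
        ∑ i ∈ Finset.range (k + 1), a i * (j * h : ℂ) ^ i = a k * h ^ k * k.factorial := by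
      simp only [Finset.mul_sum]
      rw [Finset.sum_comm]
      have : ∀ i ∈ Finset.range (k + 1), ∑ j ∈ Finset.range (k + 1),
          (-1) ^ (k - j) * (k.choose j : ℂ) * (a i * (j * h : ℂ) ^ i) =
            a i * h ^ i * if i = k then (k.factorial : ℂ) else 0 := fun i hi ↦ by
        rw [← sum_choose_mul_pow k i (Nat.lt_succ_iff.1 (Finset.mem_range.1 hi)), Finset.mul_sum]
        refine Finset.sum_congr rfl fun j _ ↦ ?_
        ring
      rw [Finset.sum_congr rfl this]
      simp
    simp only [hR, mul_sub, Finset.sum_sub_distrib]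
    rw [hpoly, evalComb_diffWeight]
    have : (k.factorial : ℂ) ≠ 0 := by exact_mod_cast k.factorial_ne_zero
    congr 1
    field_simp
  rw [hmain, norm_mul]
  have hsumb : ‖∑ j ∈ Finset.range (k + 1), (-1) ^ (k - j) * (k.choose j : ℂ) * R j‖ ≤
      ∑ j ∈ Finset.range (k + 1), k.choose j * (B * (3 * (4 / 3 * j) ^ (k + 1)) * h ^ (k + 1)) := by
    refine norm_sum_le_of_le _ fun j hj ↦ ?_
    rw [norm_mul, norm_mul, norm_pow, norm_neg, norm_one, one_pow, one_mul, Complex.norm_natCast]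
    gcongr
    exact hRb j hj
  calc ‖((k.factorial : ℂ) * h ^ k)⁻¹‖ *
        ‖∑ j ∈ Finset.range (k + 1), (-1) ^ (k - j) * (k.choose j : ℂ) * R j‖
      ≤ ((k.factorial : ℝ) * h ^ k)⁻¹ * ∑ j ∈ Finset.range (k + 1),
          k.choose j * (B * (3 * (4 / 3 * j) ^ (k + 1)) * h ^ (k + 1)) := by
        gcongr
        rw [norm_inv, norm_mul, norm_pow, Complex.norm_natCast, Complex.norm_real,
          Real.norm_of_nonneg h0.le]
    _ = diffConst k * B * h := by
        have : ∑ j ∈ Finset.range (k + 1),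
            (k.choose j : ℝ) * (B * (3 * (4 / 3 * j) ^ (k + 1)) * h ^ (k + 1)) =
            (∑ j ∈ Finset.range (k + 1), k.choose j * (3 * (4 / 3 * j) ^ (k + 1) : ℝ)) *
              (B * h ^ (k + 1)) := by
          rw [Finset.sum_mul]
          refine Finset.sum_congr rfl fun j _ ↦ ?_
          ring
        rw [this, diffConst]
        generalize ∑ j ∈ Finset.range (k + 1), k.choose j * (3 * (4 / 3 * j) ^ (k + 1) : ℝ) = S
        rw [pow_succ]
        field_simp

theorem hasSum_szego (t : Torus) (z : Disk) :
    HasSum (fun n ↦ (AddCircle.toCircle (-t) : ℂ) ^ n * (z : ℂ) ^ n) (szego z t) := by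
  have := hasSum_geometric_of_norm_lt_one (norm_mul_toCircle_neg z t)
  rw [szego, one_div]
  simpa only [mul_pow, mul_comm] using this

/-- Weights whose linear combinations of values tend to `∑ k, c k * coeff k f`. -/
def coeffWeight {m : ℕ} (c : Fin m → ℂ) (N : ℕ) : Disk →₀ ℂ :=
  ∑ k, c k • diffWeight k (1 / ((N : ℝ) + 1))

theorem evalComb_coeffWeight {m : ℕ} (c : Fin m → ℂ) (N : ℕ) (f : Disk → ℂ) :
    evalComb (coeffWeight c N) f = ∑ k, c k * evalComb (diffWeight k (1 / ((N : ℝ) + 1))) f := by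
  simp [evalComb, coeffWeight, map_sum]

/-- The threshold on `N` does not depend on `f`, which provides a dominating function in `t` later
on. -/
theorem eventually_norm_evalComb_coeffWeight_sub_le {m : ℕ} (c : Fin m → ℂ) :
    ∀ᶠ N : ℕ in atTop, ∀ (f : Disk → ℂ) (a : ℕ → ℂ) (B : ℝ),
      (∀ z : Disk, HasSum (fun n ↦ a n * (z : ℂ) ^ n) (f z)) → (∀ n, ‖a n‖ ≤ B * (4 / 3) ^ n) →
      ‖evalComb (coeffWeight c N) f - ∑ k, c k * a k‖ ≤
        (∑ k, ‖c k‖ * diffConst k) * B * (1 / ((N : ℝ) + 1)) := by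
  filter_upwards [eventually_ge_atTop (2 * m)] with N hN f a B hf ha
  rw [evalComb_coeffWeight, ← Finset.sum_sub_distrib, Finset.sum_mul, Finset.sum_mul]
  refine norm_sum_le_of_le _ fun k _ ↦ ?_
  rw [← mul_sub, norm_mul, mul_assoc, mul_assoc, ← mul_assoc (diffConst _)]
  gcongr
  refine norm_evalComb_diffWeight_sub_le hf ha k (by positivity) ?_
  rw [mul_one_div, div_le_div_iff₀ (by positivity) two_pos]
  have h1 : (k : ℕ) * 2 ≤ 1 * (N + 1) := by omega
  exact_mod_cast h1

theorem tendsto_evalComb_coeffWeight {m : ℕ} (c : Fin m → ℂ) {f : Disk → ℂ} {a : ℕ → ℂ} {B : ℝ}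
    (hf : ∀ z : Disk, HasSum (fun n ↦ a n * (z : ℂ) ^ n) (f z))
    (ha : ∀ n, ‖a n‖ ≤ B * (4 / 3) ^ n) :
    Tendsto (fun N ↦ evalComb (coeffWeight c N) f) atTop (𝓝 (∑ k, c k * a k)) := by
  rw [tendsto_iff_norm_sub_tendsto_zero]
  have h0 : Tendsto (fun N : ℕ ↦ (∑ k, ‖c k‖ * diffConst k) * B * (1 / ((N : ℝ) + 1)))
      atTop (𝓝 0) := by
    simpa using tendsto_one_div_add_atTop_nhds_zero_nat.const_mul
      ((∑ k, ‖c k‖ * diffConst k) * B)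
  refine tendsto_of_tendsto_of_tendsto_of_le_of_le' tendsto_const_nhds h0
    (Eventually.of_forall fun N ↦ norm_nonneg _) ?_
  filter_upwards [eventually_norm_evalComb_coeffWeight_sub_le c] with N hN
  exact hN f a B hf ha

theorem tendsto_evalComb_coeffWeight_holDisk {m : ℕ} (c : Fin m → ℂ) (f : HolDisk) :
    Tendsto (fun N ↦ evalComb (coeffWeight c N) f) atTop (𝓝 (∑ k, c k * f.coeff k)) := by
  obtain ⟨B, hB⟩ := f.exists_norm_coeff_le
  exact tendsto_evalComb_coeffWeight c f.hasSum_coeff hB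

theorem norm_toCircle_neg_pow_le (t : Torus) (n : ℕ) :
    ‖(AddCircle.toCircle (-t) : ℂ) ^ n‖ ≤ 1 * (4 / 3) ^ n := by
  rw [norm_pow, norm_toCircle_neg, one_pow, one_mul]
  exact one_le_pow₀ (by norm_num)

/-- The trigonometric polynomial `∑ k, c k * exp (-i k t)`. -/
def trigPoly {m : ℕ} (c : Fin m → ℂ) (t : Torus) : ℂ :=
  ∑ k, c k * (AddCircle.toCircle (-t) : ℂ) ^ (k : ℕ)

theorem continuous_trigPoly {m : ℕ} (c : Fin m → ℂ) : Continuous (trigPoly c) :=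
  continuous_finsetSum _ fun _ _ ↦ continuous_const.mul ((continuous_subtype_val.comp
    (AddCircle.continuous_toCircle.comp continuous_neg)).pow _)

theorem norm_trigPoly_le {m : ℕ} (c : Fin m → ℂ) (t : Torus) : ‖trigPoly c t‖ ≤ ∑ k, ‖c k‖ :=
  norm_sum_le_of_le _ fun k _ ↦ by
    rw [norm_mul, norm_pow, norm_toCircle_neg, one_pow, mul_one]

/-- The coefficients of `szego · t` are the powers of `e^{-it}`, so the combinations converge
pointwise to `trigPoly c`, with a bound independent of `t` and `N`. -/
theorem tendsto_integral_normSq_evalComb_coeffWeight {m : ℕ} (c : Fin m → ℂ)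
    (F : ProbabilityMeasure Torus) :
    Tendsto (fun N ↦ ∫ t, ‖evalComb (coeffWeight c N) (szego · t)‖ ^ 2 ∂(F : Measure Torus)) atTop
      (𝓝 (∫ t, ‖trigPoly c t‖ ^ 2 ∂(F : Measure Torus))) := by
  refine tendsto_integral_filter_of_dominated_convergence
    (fun _ ↦ (∑ k, ‖c k‖ * diffConst k + ∑ k, ‖c k‖) ^ 2) ?_ ?_ (integrable_const _) ?_
  · exact Eventually.of_forall fun N ↦
      ((continuous_evalComb_szego _).norm.pow 2).aestronglyMeasurable
  · filter_upwards [eventually_norm_evalComb_coeffWeight_sub_le c] with N hN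
    refine ae_of_all _ fun t ↦ ?_
    have h1 := hN (szego · t) _ 1 (hasSum_szego t) (norm_toCircle_neg_pow_le t)
    rw [Real.norm_of_nonneg (by positivity)]
    gcongr
    have h2 : (∑ k, ‖c k‖ * diffConst k) * 1 * (1 / ((N : ℝ) + 1)) ≤ ∑ k, ‖c k‖ * diffConst k := by
      rw [mul_one]
      refine mul_le_of_le_one_right
        (Finset.sum_nonneg fun k _ ↦ mul_nonneg (norm_nonneg _) (diffConst_nonneg _)) ?_
      rw [div_le_one (by positivity)]
      linarith [(N.cast_nonneg : (0 : ℝ) ≤ N)]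
    have h3 := norm_le_norm_add_norm_sub' (evalComb (coeffWeight c N) (szego · t)) (trigPoly c t)
    have h4 := norm_trigPoly_le c t
    have h5 : ‖evalComb (coeffWeight c N) (szego · t) - trigPoly c t‖ ≤ _ := h1
    linarith
  · exact ae_of_all _ fun t ↦ ((tendsto_evalComb_coeffWeight c (hasSum_szego t)
      (norm_toCircle_neg_pow_le t)).norm.pow 2)

/-! ### Convergence in law of Gaussian analytic functions -/

namespace IsGAF

variable {Ω : Type*} [MeasurableSpace Ω] {P : Measure Ω} {X : Ω → HolDisk}
  {F : ProbabilityMeasure Torus}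

/-- The identity for values passes to the limit on both sides, by dominated convergence over `P` and
over `F`. Gaussianity of the coefficients need not be established separately. -/
theorem integral_exp_re_coeff (h : IsGAF P X (spectralKernel F)) {m : ℕ} (c : Fin m → ℂ) :
    ∫ ω, Complex.exp ((∑ k, c k * (X ω).coeff k).re * Complex.I) ∂P =
      Complex.exp (-((∫ t, ‖trigPoly c t‖ ^ 2 ∂(F : Measure Torus) : ℝ) : ℂ) / 4) := by
  have : IsProbabilityMeasure P := h.gaussian.isProbabilityMeasure
  have hlim : Tendsto
      (fun N ↦ ∫ ω, Complex.exp ((evalComb (coeffWeight c N) (X ω)).re * Complex.I) ∂P) atTop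
      (𝓝 (∫ ω, Complex.exp ((∑ k, c k * (X ω).coeff k).re * Complex.I) ∂P)) := by
    refine tendsto_integral_of_dominated_convergence (fun _ ↦ 1) (fun N ↦ ?_) (integrable_const _)
      (fun N ↦ ae_of_all _ fun ω ↦ (Complex.norm_exp_ofReal_mul_I _).le)
      (ae_of_all _ fun ω ↦ ?_)
    · have hc : Continuous fun x : ℝ ↦ Complex.exp (x * Complex.I) := by fun_prop
      exact hc.comp_aestronglyMeasurable
        (h.hasGaussianLaw_re_evalComb _).aemeasurable.aestronglyMeasurable
    · have hc : Continuous fun x : ℂ ↦ Complex.exp (x.re * Complex.I) := by fun_prop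
      exact (hc.tendsto _).comp (tendsto_evalComb_coeffWeight_holDisk c (X ω))
  refine tendsto_nhds_unique hlim ?_
  simp only [h.integral_exp_re_evalComb]
  have hc : Continuous fun x : ℝ ↦ Complex.exp (-(x : ℂ) / 4) := by fun_prop
  exact (hc.tendsto _).comp (tendsto_integral_normSq_evalComb_coeffWeight c F)

/-- Fatou's lemma along the finite differences, whose second moments tend to `∫ |e^{-ikt}|² dF = 1`.
-/
theorem lintegral_enormSq_coeff_le (h : IsGAF P X (spectralKernel F)) (k : ℕ) :
    ∫⁻ ω, ‖(X ω).coeff k‖ₑ ^ 2 ∂P ≤ 1 := by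
  set c : Fin (k + 1) → ℂ := fun i ↦ if i = Fin.last k then 1 else 0 with hc
  have hsum : ∀ a : ℕ → ℂ, ∑ i, c i * a (i : ℕ) = a k := fun a ↦ by simp [hc]
  have htrig : ∀ t, ‖trigPoly c t‖ = 1 := fun t ↦ by
    rw [trigPoly, hsum fun n ↦ (AddCircle.toCircle (-t) : ℂ) ^ n, norm_pow, norm_toCircle_neg,
      one_pow]
  have hlim : ∀ ω, Tendsto (fun N ↦ ‖evalComb (coeffWeight c N) (X ω)‖ₑ ^ 2) atTop
      (𝓝 (‖(X ω).coeff k‖ₑ ^ 2)) := fun ω ↦ by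
    have := tendsto_evalComb_coeffWeight_holDisk c (X ω)
    rw [hsum fun n ↦ (X ω).coeff n] at this
    exact (((ENNReal.continuous_pow 2).comp continuous_enorm).tendsto _).comp this
  calc ∫⁻ ω, ‖(X ω).coeff k‖ₑ ^ 2 ∂P
      = ∫⁻ ω, liminf (fun N ↦ ‖evalComb (coeffWeight c N) (X ω)‖ₑ ^ 2) atTop ∂P :=
        lintegral_congr fun ω ↦ (hlim ω).liminf_eq.symm
    _ ≤ liminf (fun N ↦ ∫⁻ ω, ‖evalComb (coeffWeight c N) (X ω)‖ₑ ^ 2 ∂P) atTop :=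
        lintegral_liminf_le' fun N ↦
          (h.hasGaussianLaw_evalComb _).aemeasurable.enorm.pow_const 2
    _ = 1 := by
        refine Tendsto.liminf_eq ?_
        simp only [h.lintegral_enormSq_evalComb]
        have := tendsto_integral_normSq_evalComb_coeffWeight c F
        simp only [htrig, one_pow, integral_const, probReal_univ, smul_eq_mul, mul_one] at this
        have h1 := (ENNReal.continuous_ofReal.tendsto _).comp this
        rwa [ENNReal.ofReal_one] at h1

theorem lintegral_enorm_coeff_le (h : IsGAF P X (spectralKernel F)) (k : ℕ) :
    ∫⁻ ω, ‖(X ω).coeff k‖ₑ ∂P ≤ 2 := by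
  have : IsProbabilityMeasure P := h.gaussian.isProbabilityMeasure
  calc ∫⁻ ω, ‖(X ω).coeff k‖ₑ ∂P ≤ ∫⁻ ω, (1 + ‖(X ω).coeff k‖ₑ ^ 2) ∂P := by
        refine lintegral_mono fun ω ↦ ?_
        rcases le_total ‖(X ω).coeff k‖ₑ 1 with h1 | h1
        · exact h1.trans le_self_add
        · exact (le_self_pow₀ h1 two_ne_zero).trans le_add_self
    _ = 1 + ∫⁻ ω, ‖(X ω).coeff k‖ₑ ^ 2 ∂P := by
        rw [lintegral_add_left measurable_const]
        simp
    _ ≤ 1 + 1 := by gcongr; exact h.lintegral_enormSq_coeff_le k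
    _ = 2 := one_add_one_eq_two

theorem lintegral_enorm_coeff_map_le (h : IsGAF P X (spectralKernel F)) (k : ℕ) :
    ∫⁻ f, ‖HolDisk.coeff k f‖ₑ ∂(P.map X) ≤ 2 := by
  rw [lintegral_map (HolDisk.continuous_coeff k).measurable.enorm h.measurable]
  exact h.lintegral_enorm_coeff_le k

/-- The characteristic function of the law of the first Taylor coefficients. -/
theorem charFun_map_coeffs (h : IsGAF P X (spectralKernel F)) {m : ℕ}
    (x : EuclideanSpace ℂ (Fin m)) :
    charFun ((P.map X).map (HolDisk.coeffs m)) x =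
      Complex.exp (-((∫ t, ‖trigPoly (fun k ↦ (starRingEnd ℂ) (x k)) t‖ ^ 2
        ∂(F : Measure Torus) : ℝ) : ℂ) / 4) := by
  have hc : Continuous fun y : EuclideanSpace ℂ (Fin m) ↦
      Complex.exp ((inner ℝ y x : ℝ) * Complex.I) := by fun_prop
  rw [← h.integral_exp_re_coeff, charFun_apply,
    integral_map (HolDisk.continuous_coeffs m).aemeasurable
      hc.measurable.aestronglyMeasurable,
    integral_map (f := fun f ↦ Complex.exp ((inner ℝ (HolDisk.coeffs m f) x : ℝ) * Complex.I))
      h.measurable.aemeasurable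
      (hc.comp (HolDisk.continuous_coeffs m)).measurable.aestronglyMeasurable]
  congr 1 with ω
  congr 3
  -- The real inner product is `Re ∑ conj (x k) * y k`, whence the conjugated weights.
  rw [PiLp.inner_apply, Complex.re_sum]
  refine Finset.sum_congr rfl fun k _ ↦ ?_
  rw [real_inner_comm, Complex.inner, mul_comm]
  rfl

end IsGAF

/-- The error of the Taylor polynomials is, on smaller disks, controlled by the coefficients. -/
theorem HolDisk.enorm_sub_taylor_le (f : HolDisk) (m : ℕ) {r : NNReal} {z : Disk}
    (hz : ‖(z : ℂ)‖ ≤ r) :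
    ‖f z - taylor m f z‖ₑ ≤ ∑' k, ‖f.coeff (k + m)‖ₑ * (r : ℝ≥0∞) ^ (k + m) := by
  have h := (hasSum_nat_add_iff' m).2 (f.hasSum_coeff z)
  rw [← taylor_apply] at h
  rw [← h.tsum_eq]
  refine enorm_tsum_le_tsum_enorm.trans (ENNReal.tsum_le_tsum fun k ↦ ?_)
  rw [enorm_mul, enorm_pow]
  gcongr
  rw [enorm_eq_nnnorm]
  exact_mod_cast hz

theorem lintegral_tsum_coeff_le {ν : Measure HolDisk}
    (hν : ∀ k, ∫⁻ f, ‖HolDisk.coeff k f‖ₑ ∂ν ≤ 2) (m : ℕ) (r : NNReal) :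
    ∫⁻ f, ∑' k, ‖HolDisk.coeff (k + m) f‖ₑ * (r : ℝ≥0∞) ^ (k + m) ∂ν ≤
      ∑' k, 2 * (r : ℝ≥0∞) ^ (k + m) := by
  have hm : ∀ k, Measurable fun f ↦ ‖HolDisk.coeff k f‖ₑ := fun k ↦
    (HolDisk.continuous_coeff k).measurable.enorm
  rw [lintegral_tsum fun k ↦ ((hm (k + m)).mul_const _).aemeasurable]
  refine ENNReal.tsum_le_tsum fun k ↦ ?_
  rw [lintegral_mul_const _ (hm (k + m))]
  gcongr
  exact hν _

theorem exists_tsum_two_mul_pow_lt {r : NNReal} (hr : r < 1) {δ : ℝ≥0∞} (hδ : 0 < δ) :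
    ∃ m : ℕ, ∑' k, 2 * (r : ℝ≥0∞) ^ (k + m) < δ := by
  have hfin : ∑' k, 2 * (r : ℝ≥0∞) ^ k ≠ ∞ := by
    rw [ENNReal.tsum_mul_left, ENNReal.tsum_geometric]
    refine ENNReal.mul_ne_top (by simp) (ENNReal.inv_ne_top.2 ?_)
    rw [← pos_iff_ne_zero, tsub_pos_iff_lt]
    exact_mod_cast hr
  exact ((ENNReal.tendsto_sum_nat_add _ hfin).eventually (gt_mem_nhds hδ)).exists

theorem exists_norm_le_of_isCompact {K : Set Disk} (hK : IsCompact K) :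
    ∃ r : NNReal, r < 1 ∧ ∀ z ∈ K, ‖(z : ℂ)‖ ≤ r := by
  rcases K.eq_empty_or_nonempty with rfl | hne
  · exact ⟨0, one_pos, by simp⟩
  · obtain ⟨z₀, -, h⟩ := hK.exists_isMaxOn hne (f := fun z : Disk ↦ ‖(z : ℂ)‖₊)
      (by fun_prop)
    exact ⟨‖(z₀ : ℂ)‖₊, by exact_mod_cast mem_ball_zero_iff.1 z₀.2, fun z hz ↦ by
      exact_mod_cast h hz⟩

/-- Convergence in law in the space of analytic functions follows from convergence in law of the
Taylor coefficients, if the latter are bounded in mean. -/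
theorem tendsto_of_tendsto_map_coeffs {μ : ℕ → ProbabilityMeasure HolDisk}
    {μ₀ : ProbabilityMeasure HolDisk}
    (hμ : ∀ m, Tendsto (fun n ↦ (μ n).map (HolDisk.continuous_coeffs m).aemeasurable) atTop
      (𝓝 (μ₀.map (HolDisk.continuous_coeffs m).aemeasurable)))
    (hb : ∀ n k, ∫⁻ f, ‖HolDisk.coeff k f‖ₑ ∂(μ n : Measure HolDisk) ≤ 2)
    (hb₀ : ∀ k, ∫⁻ f, ‖HolDisk.coeff k f‖ₑ ∂(μ₀ : Measure HolDisk) ≤ 2) :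
    Tendsto μ atTop (𝓝 μ₀) := by
  let : PseudoMetricSpace HolDisk := UniformSpace.pseudoMetricSpace HolDisk
  refine tendsto_of_forall_tendsto_map HolDisk.continuous_taylor (fun m ↦ ?_) fun ε hε ↦ ?_
  · have := ProbabilityMeasure.tendsto_map_of_tendsto_of_continuous _ _ (hμ m)
      (HolDisk.continuous_ofCoeffs m)
    have hmap : ∀ ν : ProbabilityMeasure HolDisk,
        (ν.map (HolDisk.continuous_coeffs m).aemeasurable).map
          (HolDisk.continuous_ofCoeffs m).aemeasurable =
            ν.map (HolDisk.continuous_taylor m).aemeasurable := fun ν ↦ by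
      apply Subtype.ext
      exact Measure.map_map (HolDisk.continuous_ofCoeffs m).measurable
        (HolDisk.continuous_coeffs m).measurable
    simpa only [hmap] using this
  · obtain ⟨K, hK, δ, hδ, hKδ⟩ :=
      HolDisk.exists_isCompact_forall_mem (Metric.dist_mem_uniformity hε)
    obtain ⟨r, hr, hKr⟩ := exists_norm_le_of_isCompact hK
    -- The tail is made smaller than `δ * ε` so that Markov's inequality at level `δ` leaves mass at
    -- most `ε`. The choice of `m` does not involve the measure.
    obtain ⟨m, hm⟩ := exists_tsum_two_mul_pow_lt hr
      (δ := ENNReal.ofReal δ * ENNReal.ofReal ε) (by simp [hδ, hε])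
    have key : ∀ ν : ProbabilityMeasure HolDisk,
        (∀ k, ∫⁻ f, ‖HolDisk.coeff k f‖ₑ ∂(ν : Measure HolDisk) ≤ 2) →
        (ν : Measure HolDisk).real {f | ε ≤ dist f (HolDisk.taylor m f)} ≤ ε := fun ν hν ↦ by
      refine ENNReal.toReal_le_of_le_ofReal hε.le ?_
      have hδ' : ENNReal.ofReal δ ≠ 0 := by simpa using hδ
      have hsub : {f | ε ≤ dist f (HolDisk.taylor m f)} ⊆ {f | ENNReal.ofReal δ ≤
          ∑' k, ‖HolDisk.coeff (k + m) f‖ₑ * (r : ℝ≥0∞) ^ (k + m)} := fun f hf ↦ by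
        by_contra hlt
        refine absurd (show dist f (HolDisk.taylor m f) < ε from hKδ f _ fun z hz ↦ ?_) (not_lt.2 hf)
        have h1 := (f.enorm_sub_taylor_le m (hKr z hz)).trans_lt (not_le.1 hlt)
        rw [← ofReal_norm] at h1
        exact (ENNReal.ofReal_lt_ofReal_iff hδ).1 h1
      have hmul := (mul_meas_ge_le_lintegral₀ (μ := (ν : Measure HolDisk))
        (f := fun f ↦ ∑' k, ‖HolDisk.coeff (k + m) f‖ₑ * (r : ℝ≥0∞) ^ (k + m))
        (Measurable.tsum fun k ↦
          (HolDisk.continuous_coeff _).measurable.enorm.mul_const _).aemeasurable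
        (ENNReal.ofReal δ)).trans ((lintegral_tsum_coeff_le hν m r).trans hm.le)
      exact (measure_mono hsub).trans
        ((ENNReal.mul_le_mul_iff_right hδ' ENNReal.ofReal_ne_top).1 hmul)
    exact ⟨m, key μ₀ hb₀, fun n ↦ key (μ n) (hb n)⟩

/-- Weak convergence of the spectral measures implies convergence in law of the Gaussian analytic
functions. -/
theorem tendstoInDistribution_of_tendsto
    {F : ℕ → ProbabilityMeasure Torus} {F_lim : ProbabilityMeasure Torus}
    (hF : Tendsto F atTop (𝓝 F_lim))
    {Ω : ℕ → Type*} [∀ n, MeasurableSpace (Ω n)]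
    {P : ∀ n, Measure (Ω n)} [∀ n, IsProbabilityMeasure (P n)]
    {Ω_lim : Type*} [MeasurableSpace Ω_lim]
    {P_lim : Measure Ω_lim} [IsProbabilityMeasure P_lim]
    {X : ∀ n, Ω n → HolDisk} {X_lim : Ω_lim → HolDisk}
    (hX : ∀ n, IsGAF (P n) (X n) (spectralKernel (F n)))
    (hX_lim : IsGAF P_lim X_lim (spectralKernel F_lim)) :
    TendstoInDistribution X atTop X_lim P P_lim := by
  refine ⟨fun n ↦ (hX n).measurable.aemeasurable, hX_lim.measurable.aemeasurable,
    tendsto_of_tendsto_map_coeffs (fun m ↦ ?_) (fun n ↦ (hX n).lintegral_enorm_coeff_map_le)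
      hX_lim.lintegral_enorm_coeff_map_le⟩
  rw [ProbabilityMeasure.tendsto_iff_tendsto_charFun]
  intro x
  have hc : Continuous fun x : ℝ ↦ Complex.exp (-(x : ℂ) / 4) := by fun_prop
  -- The characteristic function depends on the spectral measure only through the integral of this
  -- continuous function; weak convergence enters here.
  let g : BoundedContinuousFunction Torus ℝ := BoundedContinuousFunction.mkOfCompact
    ⟨fun t ↦ ‖trigPoly (fun k ↦ (starRingEnd ℂ) (x k)) t‖ ^ 2, (continuous_trigPoly _).norm.pow 2⟩
  have hg := (hc.tendsto _).comp
    (ProbabilityMeasure.tendsto_iff_forall_integral_tendsto.1 hF g)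
  have e₀ := hX_lim.charFun_map_coeffs x
  have e := fun n ↦ (hX n).charFun_map_coeffs x
  refine (hg.congr fun n ↦ (e n).symm).trans_eq ?_
  exact congrArg 𝓝 e₀.symm

/-! ### Hurwitz's theorem -/

open MeromorphicOn in
/-- Jensen's formula on two circles: if there are no zeros between them, then the number of zeros
inside is read off from the circle averages of `log ‖g‖`. -/
theorem circleAverage_log_norm_sub {g : ℂ → ℂ} {c : ℂ} {r₁ r₂ : ℝ} (h₁ : 0 < r₁) (h₁₂ : r₁ < r₂)
    (hg : AnalyticOnNhd ℂ g (Metric.closedBall c r₂))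
    (hne : ∀ z, r₁ ≤ ‖z - c‖ → ‖z - c‖ ≤ r₂ → g z ≠ 0) :
    Real.circleAverage (fun z ↦ Real.log ‖g z‖) c r₂ -
        Real.circleAverage (fun z ↦ Real.log ‖g z‖) c r₁ =
      (∑ᶠ u, divisor g (Metric.closedBall c r₂) u : ℤ) * (Real.log r₂ - Real.log r₁) := by
  have h₂ : 0 < r₂ := h₁.trans h₁₂
  have hsub : Metric.closedBall c r₁ ⊆ Metric.closedBall c r₂ :=
    Metric.closedBall_subset_closedBall h₁₂.le
  have hg₁ := hg.mono hsub
  have hD : ∀ u, divisor g (Metric.closedBall c r₁) u = divisor g (Metric.closedBall c r₂) u := by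
    intro u
    by_cases hu₁ : u ∈ Metric.closedBall c r₁
    · rw [divisor_apply hg₁.meromorphicOn hu₁, divisor_apply hg.meromorphicOn (hsub hu₁)]
    · rw [divisor_def, if_neg fun h ↦ hu₁ h.2]
      by_cases hu₂ : u ∈ Metric.closedBall c r₂
      · rw [AnalyticOnNhd.divisor_apply hg hu₂, (hg u hu₂).analyticOrderAt_eq_zero.2]
        · simp
        · rw [mem_closedBall_iff_norm, not_le] at hu₁
          exact hne u hu₁.le (mem_closedBall_iff_norm.1 hu₂)
      · rw [divisor_def, if_neg fun h ↦ hu₂ h.2]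
  have hfin : (divisor g (Metric.closedBall c r₂) : ℂ → ℤ).HasFiniteSupport :=
    (divisor g (Metric.closedBall c r₂)).finiteSupport (isCompact_closedBall c r₂)
  -- In Jensen's formula the terms `log ‖c - u‖` and the trailing coefficient do not depend on `r`,
  -- so they cancel in the difference of the two circles, even if `g` vanishes at `c`.
  have key : ∀ r, 0 < r → AnalyticOnNhd ℂ g (Metric.closedBall c r) →
      (∀ u, divisor g (Metric.closedBall c r) u = divisor g (Metric.closedBall c r₂) u) →
      Real.circleAverage (fun z ↦ Real.log ‖g z‖) c r =
        ∑ᶠ u, (divisor g (Metric.closedBall c r₂) u * (Real.log r - Real.log ‖c - u‖)) +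
          Real.log ‖meromorphicTrailingCoeffAt g c‖ := by
    intro r hr hgr hDr
    have h := MeromorphicOn.circleAverage_log_norm (c := c) (R := r) (f := g) hr.ne'
      (by rw [abs_of_pos hr]; exact hgr.meromorphicOn)
    rw [abs_of_pos hr] at h
    rw [h, countingFunction_finsum_eq_finsum_add hr.ne' hfin]
    simp only [hDr]
  rw [key r₂ h₂ hg fun _ ↦ rfl, key r₁ h₁ hg₁ hD, add_sub_add_right_eq_sub,
    ← finsum_sub_distrib]
  · simp only [← mul_sub, sub_sub_sub_cancel_right]
    rw [← finsum_mul]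
    congr 1
    exact (map_finsum (Int.castRingHom ℝ) hfin).symm
  · exact hfin.subset fun u hu h ↦ hu (by simp [h])
  · exact hfin.subset fun u hu h ↦ hu (by simp [h])

namespace HolDisk

theorem continuousOn_extendZero (f : HolDisk) : ContinuousOn (extendZero f) Disk :=
  DifferentiableOn.continuousOn f.2

theorem analyticOnNhd_extendZero (f : HolDisk) : AnalyticOnNhd ℂ (extendZero f) Disk :=
  DifferentiableOn.analyticOnNhd f.2 Metric.isOpen_ball

theorem analyticOrderAt_ne_top {f : HolDisk} (hf : ∃ z, f z ≠ 0) (z : Disk) :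
    analyticOrderAt (extendZero f) z ≠ ⊤ := by
  intro h
  obtain ⟨w, hw⟩ := hf
  refine hw ?_
  have := f.analyticOnNhd_extendZero.eqOn_zero_of_preconnected_of_eventuallyEq_zero
    (convex_ball 0 1).isPreconnected z.2 (analyticOrderAt_eq_top.1 h) w.2
  rwa [extendZero_apply] at this

theorem zeroMult_eq_zero {f : HolDisk} {z : Disk} (hz : f z ≠ 0) : f.zeroMult z = 0 := by
  rw [zeroMult, analyticOrderNatAt, (f.analyticOnNhd_extendZero z z.2).analyticOrderAt_eq_zero.2]
  · rfl
  · rwa [extendZero_apply]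

theorem zeroMult_ne_zero {f : HolDisk} (hf : ∃ z, f z ≠ 0) {z : Disk} (hz : f z = 0) :
    f.zeroMult z ≠ 0 := by
  rw [zeroMult, analyticOrderNatAt, ne_eq, ENat.toNat_eq_zero, not_or]
  refine ⟨fun h ↦ ?_, analyticOrderAt_ne_top hf z⟩
  rw [(f.analyticOnNhd_extendZero z z.2).analyticOrderAt_eq_zero, extendZero_apply] at h
  exact h hz

theorem eventually_ne_zero_nhdsNE {f : HolDisk} (hf : ∃ z, f z ≠ 0) (z : Disk) :
    ∀ᶠ w in 𝓝 z, w ≠ z → f w ≠ 0 := by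
  have h := ((f.analyticOnNhd_extendZero z z.2).eventually_eq_zero_or_eventually_ne_zero
    ).resolve_left fun h ↦ analyticOrderAt_ne_top hf z (analyticOrderAt_eq_top.2 h)
  rw [eventually_nhdsWithin_iff] at h
  filter_upwards [continuous_subtype_val.continuousAt.eventually h] with w hw hwz
  have := hw (fun h ↦ hwz (Subtype.ext h))
  rwa [extendZero_apply] at this

/-- A bound from below on a compact set persists nearby, up to a factor `2`. -/
theorem eventually_forall_ne_zero {f : HolDisk} {K : Set Disk} (hK : IsCompact K)
    (hf : ∀ z ∈ K, f z ≠ 0) :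
    ∃ a > 0, ∀ᶠ g : HolDisk in 𝓝 f, ∀ z ∈ K, a ≤ ‖g z‖ := by
  rcases K.eq_empty_or_nonempty with rfl | hne
  · exact ⟨1, one_pos, by simp⟩
  · obtain ⟨z₀, hz₀, hmin⟩ := hK.exists_isMinOn hne (f := fun z ↦ ‖f z‖)
      (f.1.continuous.norm.continuousOn)
    have h0 : 0 < ‖f z₀‖ := norm_pos_iff.2 (hf z₀ hz₀)
    refine ⟨‖f z₀‖ / 2, by positivity, ?_⟩
    filter_upwards [f.eventually_forall_dist_lt hK (half_pos h0)] with g hg z hz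
    have h1 := hg z hz
    have h2 : ‖f z₀‖ ≤ ‖f z‖ := hmin hz
    have h3 := norm_le_norm_add_norm_sub' (f z) (g z)
    linarith

theorem eventually_forall_norm_le (f : HolDisk) {K : Set Disk} (hK : IsCompact K) :
    ∃ b > 0, ∀ᶠ g : HolDisk in 𝓝 f, ∀ z ∈ K, ‖g z‖ ≤ b := by
  obtain ⟨C, hC⟩ := hK.exists_bound_of_continuousOn f.1.continuous.continuousOn
  refine ⟨|C| + 1, by positivity, ?_⟩
  filter_upwards [f.eventually_forall_dist_lt hK one_pos] with g hg z hz
  have h1 := hg z hz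
  have h2 : ‖f z‖ ≤ C := hC z hz
  have h3 := norm_le_norm_add_norm_sub' (g z) (f z)
  rw [norm_sub_rev] at h3
  linarith [le_abs_self C]

theorem isCompact_preimage_val {K : Set ℂ} (hK : IsCompact K) (hKD : K ⊆ Disk) :
    IsCompact (Subtype.val ⁻¹' K : Set Disk) := by
  rw [Subtype.isCompact_iff, Subtype.image_preimage_coe, Set.inter_eq_self_of_subset_right hKD]
  exact hK

theorem tendsto_eval (f : HolDisk) (z : Disk) : Tendsto (fun g : HolDisk ↦ g z) (𝓝 f) (𝓝 (f z)) :=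
  (f.tendstoUniformlyOn_nhds isCompact_singleton).tendsto_at rfl

theorem abs_log_le {a b x : ℝ} (ha : 0 < a) (hax : a ≤ x) (hxb : x ≤ b) :
    |Real.log x| ≤ |Real.log a| + |Real.log b| := by
  have h1 := Real.log_le_log ha hax
  have h2 := Real.log_le_log (ha.trans_le hax) hxb
  rw [abs_le]
  constructor
  · linarith [neg_abs_le (Real.log a), abs_nonneg (Real.log b)]
  · linarith [le_abs_self (Real.log b), abs_nonneg (Real.log a)]

/-- For `g` near `f`, `|g|` stays between two positive constants on the circle, so `log |g|` is
bounded and dominated convergence applies. -/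
theorem tendsto_circleAverage_log_norm {f : HolDisk} {c : ℂ} {r : ℝ} (hr : 0 < r)
    (hD : Metric.sphere c r ⊆ Disk) (hf : ∀ z : Disk, (z : ℂ) ∈ Metric.sphere c r → f z ≠ 0) :
    Tendsto (fun g : HolDisk ↦ Real.circleAverage (fun z ↦ Real.log ‖extendZero g z‖) c r) (𝓝 f)
      (𝓝 (Real.circleAverage (fun z ↦ Real.log ‖extendZero f z‖) c r)) := by
  have hK := isCompact_preimage_val (isCompact_sphere c r) hD
  obtain ⟨a, ha, hga⟩ := eventually_forall_ne_zero hK hf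
  obtain ⟨b, hb, hgb⟩ := f.eventually_forall_norm_le hK
  have hmem : ∀ θ, circleMap c r θ ∈ Metric.sphere c r := circleMap_mem_sphere c hr.le
  unfold Real.circleAverage
  refine Tendsto.const_smul ?_ _
  refine intervalIntegral.tendsto_integral_filter_of_dominated_convergence
    (fun _ ↦ |Real.log a| + |Real.log b|) ?_ ?_ (by simp) ?_
  · refine Eventually.of_forall fun g ↦ Measurable.aestronglyMeasurable ?_
    refine Real.measurable_log.comp (Continuous.measurable ?_)
    exact (g.continuousOn_extendZero.comp_continuous (continuous_circleMap c r)
      fun θ ↦ hD (hmem θ)).norm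
  · filter_upwards [hga, hgb] with g h1 h2
    refine ae_of_all _ fun θ _ ↦ ?_
    rw [g.extendZero_of_mem (hD (hmem θ))]
    exact abs_log_le ha (h1 ⟨_, hD (hmem θ)⟩ (hmem θ)) (h2 ⟨_, hD (hmem θ)⟩ (hmem θ))
  · refine ae_of_all _ fun θ _ ↦ ?_
    simp only [extendZero_of_mem _ (hD (hmem θ))]
    exact (f.tendsto_eval _).norm.log (norm_ne_zero_iff.2 (hf ⟨_, hD (hmem θ)⟩ (hmem θ)))

end HolDisk

instance (f : HolDisk) : IsFiniteMeasureOnCompacts (zeroMeasure f) where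
  lt_top_of_isCompact {K} hK := by
    obtain ⟨n, hn⟩ := isPointConfig_zeroMeasure f K hK K subset_rfl hK.measurableSet
    rw [hn]
    exact ENNReal.natCast_lt_top n

theorem zeroMeasure_eq_zero {f : HolDisk} {S : Set Disk} (hS : MeasurableSet S)
    (h : ∀ z ∈ S, f z ≠ 0) : zeroMeasure f S = 0 := by
  rw [zeroMeasure, Measure.sum_apply _ hS, ENNReal.tsum_eq_zero]
  intro z
  by_cases hz : z ∈ S
  · simp [HolDisk.zeroMult_eq_zero (h z hz)]
  · simp [Measure.dirac_apply' _ hS, hz]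

open MeromorphicOn in
theorem zeroMeasure_real_preimage_closedBall (f : HolDisk) {c : ℂ} {r : ℝ}
    (hD : Metric.closedBall c r ⊆ Disk) :
    (zeroMeasure f).real (Subtype.val ⁻¹' Metric.closedBall c r) =
      (∑ᶠ u, divisor (extendZero f) (Metric.closedBall c r) u : ℤ) := by
  classical
  set S : Set Disk := Subtype.val ⁻¹' Metric.closedBall c r with hS
  have hSm : MeasurableSet S := Metric.isClosed_closedBall.measurableSet.preimage
    measurable_subtype_coe
  have hfin := f.finite_zeroMult_ne_zero
    (HolDisk.isCompact_preimage_val (isCompact_closedBall c r) hD)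
  have han := f.analyticOnNhd_extendZero.mono hD
  have hdiv : ∀ z ∈ S, divisor (extendZero f) (Metric.closedBall c r) z = f.zeroMult z := by
    intro z hz
    rw [AnalyticOnNhd.divisor_apply han hz, HolDisk.zeroMult, analyticOrderNatAt]
    -- Infinite order, which occurs for the zero function, counts as `0` in both conventions.
    cases analyticOrderAt (extendZero f) z <;> rfl
  have h1 : zeroMeasure f S = ((∑ z ∈ hfin.toFinset, f.zeroMult z : ℕ) : ℝ≥0∞) := by
    rw [zeroMeasure, Measure.sum_apply _ hSm, tsum_eq_sum (s := hfin.toFinset)]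
    · push_cast
      refine Finset.sum_congr rfl fun z hz ↦ ?_
      have hzS : z ∈ S := ((Set.Finite.mem_toFinset hfin).1 hz).1
      simp [Measure.dirac_apply' _ hSm, hzS]
    · intro z hz
      by_cases hzS : z ∈ S
      · have : f.zeroMult z = 0 := by
          by_contra hne
          exact hz ((Set.Finite.mem_toFinset hfin).2 ⟨hzS, hne⟩)
        simp [this]
      · simp [Measure.dirac_apply' _ hSm, hzS]
  have h2 : ∑ᶠ u, divisor (extendZero f) (Metric.closedBall c r) u =
      ((∑ z ∈ hfin.toFinset, f.zeroMult z : ℕ) : ℤ) := by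
    rw [finsum_eq_sum_of_support_subset (s := hfin.toFinset.map (Function.Embedding.subtype _)),
      Finset.sum_map, Nat.cast_sum]
    · exact Finset.sum_congr rfl fun z hz ↦ hdiv z ((Set.Finite.mem_toFinset hfin).1 hz).1
    · intro u hu
      have huB : u ∈ Metric.closedBall c r :=
        (divisor (extendZero f) (Metric.closedBall c r)).supportWithinDomain hu
      have hu' : (⟨u, hD huB⟩ : Disk) ∈ S := huB
      rw [Finset.coe_map]
      refine ⟨⟨u, hD huB⟩, (Set.Finite.mem_toFinset hfin).2 ⟨hu', fun h0 ↦ hu ?_⟩, rfl⟩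
      rw [hdiv ⟨u, hD huB⟩ hu', h0]
      rfl
  rw [h2, measureReal_def, h1, ENNReal.toReal_natCast, Int.cast_natCast]

/-- **Hurwitz's theorem**: functions close to `f` have as many zeros as `f` in a closed ball, if
`f` does not vanish near its boundary. -/
theorem HolDisk.eventually_zeroMeasure_real_eq {f : HolDisk} {c : ℂ} {r₁ r₂ : ℝ} (h₁ : 0 < r₁)
    (h₁₂ : r₁ < r₂) (hD : Metric.closedBall c r₂ ⊆ Disk)
    (hf : ∀ z : Disk, r₁ ≤ ‖(z : ℂ) - c‖ → ‖(z : ℂ) - c‖ ≤ r₂ → f z ≠ 0) :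
    ∀ᶠ g in 𝓝 f, (zeroMeasure g).real (Subtype.val ⁻¹' Metric.closedBall c r₂) =
      (zeroMeasure f).real (Subtype.val ⁻¹' Metric.closedBall c r₂) := by
  have h₂ : 0 < r₂ := h₁.trans h₁₂
  set A : Set ℂ := Metric.closedBall c r₂ \ Metric.ball c r₁ with hA
  have hAD : A ⊆ Disk := Set.sdiff_subset.trans hD
  have hAc : IsCompact (Subtype.val ⁻¹' A : Set Disk) :=
    isCompact_preimage_val ((isCompact_closedBall c r₂).diff Metric.isOpen_ball) hAD
  have hmemA : ∀ z, z ∈ A ↔ ‖z - c‖ ≤ r₂ ∧ r₁ ≤ ‖z - c‖ := fun z ↦ by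
    rw [hA, Set.mem_sdiff, mem_closedBall_iff_norm, mem_ball_iff_norm, not_lt]
  obtain ⟨a, ha, hga⟩ := eventually_forall_ne_zero hAc fun z hz ↦
    hf z ((hmemA z).1 hz).2 ((hmemA z).1 hz).1
  have hlog : 0 < Real.log r₂ - Real.log r₁ := sub_pos.2 (Real.log_lt_log h₁ h₁₂)
  have hcount : ∀ g : HolDisk, (∀ z ∈ (Subtype.val ⁻¹' A : Set Disk), a ≤ ‖g z‖) →
      (zeroMeasure g).real (Subtype.val ⁻¹' Metric.closedBall c r₂) =
        (Real.circleAverage (fun z ↦ Real.log ‖extendZero g z‖) c r₂ -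
          Real.circleAverage (fun z ↦ Real.log ‖extendZero g z‖) c r₁) /
            (Real.log r₂ - Real.log r₁) := fun g hg ↦ by
    rw [eq_div_iff hlog.ne', zeroMeasure_real_preimage_closedBall g hD,
      circleAverage_log_norm_sub h₁ h₁₂ (g.analyticOnNhd_extendZero.mono hD)]
    intro z hz₁ hz₂
    have hzA : z ∈ A := (hmemA z).2 ⟨hz₂, hz₁⟩
    rw [g.extendZero_of_mem (hAD hzA), ← norm_pos_iff]
    exact ha.trans_le (hg ⟨z, hAD hzA⟩ hzA)
  have hsphere : ∀ r, r₁ ≤ r → r ≤ r₂ → Metric.sphere c r ⊆ A := fun r hr₁ hr₂ z hz ↦ by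
    rw [mem_sphere_iff_norm] at hz
    exact (hmemA z).2 ⟨hz.trans_le hr₂, hr₁.trans_eq hz.symm⟩
  have hlimr : ∀ r, r₁ ≤ r → r ≤ r₂ → Tendsto
      (fun g : HolDisk ↦ Real.circleAverage (fun z ↦ Real.log ‖extendZero g z‖) c r) (𝓝 f)
      (𝓝 (Real.circleAverage (fun z ↦ Real.log ‖extendZero f z‖) c r)) := fun r hr₁ hr₂ ↦ by
    refine tendsto_circleAverage_log_norm (h₁.trans_le hr₁) ((hsphere r hr₁ hr₂).trans hAD)
      fun z hz ↦ ?_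
    have := (hmemA z).1 (hsphere r hr₁ hr₂ hz)
    exact hf z this.2 this.1
  have hlim : Tendsto (fun g : HolDisk ↦
      (zeroMeasure g).real (Subtype.val ⁻¹' Metric.closedBall c r₂)) (𝓝 f)
      (𝓝 ((zeroMeasure f).real (Subtype.val ⁻¹' Metric.closedBall c r₂))) := by
    rw [hcount f hga.self_of_nhds]
    refine Tendsto.congr' ?_ (((hlimr r₂ h₁₂.le le_rfl).sub (hlimr r₁ le_rfl h₁₂.le)).div_const _)
    filter_upwards [hga] with g hg using (hcount g hg).symm
  have hint : ∀ g : HolDisk, ∃ n : ℤ,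
      (zeroMeasure g).real (Subtype.val ⁻¹' Metric.closedBall c r₂) = n := fun g ↦
    ⟨_, zeroMeasure_real_preimage_closedBall g hD⟩
  -- Integers at distance less than `1` coincide, so convergence of the counts forces eventual
  -- equality.
  filter_upwards [Metric.tendsto_nhds.1 hlim 1 one_pos] with g hg
  obtain ⟨n, hn⟩ := hint g
  obtain ⟨n', hn'⟩ := hint f
  rw [hn, hn'] at hg ⊢
  rw [Int.dist_cast_real, Int.dist_eq] at hg
  have : |n - n'| < 1 := by exact_mod_cast hg
  rw [Int.abs_lt_one_iff, sub_eq_zero] at this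
  rw [this]

/-! ### Continuity of the zero configuration -/

namespace HolDisk

/-- A radius that isolates each of finitely many points from the other zeros of `f`, and on which
`g` is nearly constant. -/
theorem exists_isolating_radius {f : HolDisk} (hf : ∃ z, f z ≠ 0) {g : Disk → ℝ}
    (hg : Continuous g) (T : Finset Disk) {ε : ℝ} (hε : 0 < ε) :
    ∃ r > 0, (∀ z ∈ T, Metric.closedBall (z : ℂ) r ⊆ Disk ∧
      ∀ w ∈ Metric.closedBall z r, (w ≠ z → f w ≠ 0) ∧ |g w - g z| ≤ ε) ∧
      (T : Set Disk).PairwiseDisjoint fun z ↦ Metric.closedBall z r := by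
  have h1 : ∀ z ∈ T, ∀ᶠ r : ℝ in 𝓝[>] 0, Metric.closedBall (z : ℂ) r ⊆ Disk := fun z _ ↦
    eventually_nhdsWithin_of_eventually_nhds
      (eventually_closedBall_subset (Metric.isOpen_ball.mem_nhds z.2))
  have h2 : ∀ z ∈ T, ∀ᶠ r : ℝ in 𝓝[>] 0,
      ∀ w ∈ Metric.closedBall z r, (w ≠ z → f w ≠ 0) ∧ |g w - g z| ≤ ε := fun z _ ↦ by
    have hev : ∀ᶠ w in 𝓝 z, (w ≠ z → f w ≠ 0) ∧ |g w - g z| ≤ ε :=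
      (eventually_ne_zero_nhdsNE hf z).and <|
        ((Metric.tendsto_nhds.1 (hg.tendsto z)) ε hε).mono fun w hw ↦ by
          rw [Real.dist_eq] at hw
          exact hw.le
    exact eventually_nhdsWithin_of_eventually_nhds
      ((eventually_closedBall_subset hev).mono fun r hr w hw ↦ hr hw)
  have h3 : ∀ z ∈ T, ∀ z' ∈ T, z ≠ z' → ∀ᶠ r : ℝ in 𝓝[>] 0, r + r < dist z z' := by
    intro z _ z' _ hne
    have : Tendsto (fun r : ℝ ↦ r + r) (𝓝 0) (𝓝 0) := by
      have hc : Continuous fun r : ℝ ↦ r + r := by fun_prop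
      simpa using hc.tendsto 0
    exact eventually_nhdsWithin_of_eventually_nhds (this.eventually_lt_const (dist_pos.2 hne))
  have h3' : ∀ᶠ r : ℝ in 𝓝[>] 0, ∀ z ∈ T, ∀ z' ∈ T, z ≠ z' → r + r < dist z z' := by
    refine (Finset.eventually_all T).2 fun z hz ↦ (Finset.eventually_all T).2 fun z' hz' ↦ ?_
    by_cases hne : z = z'
    · exact Eventually.of_forall fun _ h ↦ absurd hne h
    · exact (h3 z hz z' hz' hne).mono fun _ h _ ↦ h
  obtain ⟨r, ⟨⟨h1, h2⟩, h3⟩, hr⟩ := ((((Finset.eventually_all T).2 h1).and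
    ((Finset.eventually_all T).2 h2)).and h3').and self_mem_nhdsWithin |>.exists
  exact ⟨r, hr, fun z hz ↦ ⟨h1 z hz, h2 z hz⟩, fun z hz z' hz' hne ↦
    Metric.closedBall_disjoint_closedBall (h3 z hz z' hz' hne)⟩

/-- By Hurwitz, `h` has as many zeros in the ball around each point of `T` as `f` has at its centre,
and `g` varies by at most `ε` there. On the rest of the support of `g`, `h` has no zeros. Points of
`T` where `f` does not vanish carry no mass and do no harm. -/
theorem eventually_abs_integral_zeroMeasure_sub_le {f : HolDisk} (hf : ∃ z, f z ≠ 0)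
    (g : C_c(Disk, ℝ)) (T : Finset Disk) (hT : ∀ z ∈ tsupport g, f z = 0 → z ∈ T) {ε : ℝ}
    (hε : 0 < ε) :
    ∀ᶠ h in 𝓝 f, |∫ z, g z ∂zeroMeasure h - ∑ z ∈ T, (zeroMeasure f).real {z} * g z| ≤
      ε * ∑ z ∈ T, (zeroMeasure f).real {z} := by
  obtain ⟨r, hr, hTr, hdisj⟩ := exists_isolating_radius hf g.continuous T hε
  have hpre : ∀ z : Disk, Metric.closedBall z r = Subtype.val ⁻¹' Metric.closedBall (z : ℂ) r :=
    fun z ↦ rfl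
  have hcomp : ∀ z ∈ T, IsCompact (Metric.closedBall z r) := fun z hz ↦
    isCompact_preimage_val (isCompact_closedBall (z : ℂ) r) (hTr z hz).1
  have hf_real : ∀ z ∈ T, (zeroMeasure f).real (Metric.closedBall z r) =
      (zeroMeasure f).real {z} := fun z hz ↦ by
    refine measureReal_congr ?_
    refine (ae_eq_set.2 ⟨?_, ?_⟩)
    · refine zeroMeasure_eq_zero (Metric.isClosed_closedBall.measurableSet.diff
        (measurableSet_singleton z)) fun w hw ↦ ((hTr z hz).2 w hw.1).1 hw.2
    · rw [Set.sdiff_eq_empty.2 (Set.singleton_subset_iff.2 (Metric.mem_closedBall_self hr.le)),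
        measure_empty]
  have hcount : ∀ᶠ h in 𝓝 f, ∀ z ∈ T, (zeroMeasure h).real (Metric.closedBall z r) =
      (zeroMeasure f).real {z} := by
    refine (Finset.eventually_all T).2 fun z hz ↦ ?_
    -- The annulus between the radii `r / 2` and `r` omits the centre, the only possible zero of `f`
    -- in the ball.
    have hh := eventually_zeroMeasure_real_eq (f := f) (c := z) (half_pos hr) (half_lt_self hr)
      (hTr z hz).1 fun w hw₁ hw₂ ↦ by
        refine ((hTr z hz).2 w (mem_closedBall_iff_norm.2 hw₂)).1 fun hwz ↦ ?_
        rw [hwz, sub_self, norm_zero] at hw₁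
        linarith
    filter_upwards [hh] with h hh
    rw [← hf_real z hz]
    exact hh
  -- Open balls are removed to keep `K'` compact, although the integral is split along the closed
  -- ones.
  set K' : Set Disk := tsupport g \ ⋃ z ∈ T, Metric.ball z r with hK'
  have hK'c : IsCompact K' := g.hasCompactSupport.isCompact.diff
    (isOpen_biUnion fun z _ ↦ Metric.isOpen_ball)
  obtain ⟨a, ha, hga⟩ := eventually_forall_ne_zero (f := f) hK'c fun w hw hw0 ↦ hw.2
    (Set.mem_biUnion (hT w hw.1 hw0) (Metric.mem_ball_self hr))
  filter_upwards [hcount, hga] with h hcnt hh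
  have hgi : Integrable g (zeroMeasure h) :=
    g.continuous.integrable_of_hasCompactSupport g.hasCompactSupport
  have hUm : MeasurableSet (⋃ z ∈ T, Metric.closedBall z r) :=
    T.measurableSet_biUnion fun z _ ↦ Metric.isClosed_closedBall.measurableSet
  have hK'0 : zeroMeasure h K' = 0 := zeroMeasure_eq_zero hK'c.measurableSet fun z hz h0 ↦ by
    have := hh z hz
    rw [h0, norm_zero] at this
    linarith
  have hout : ∫ z in (⋃ z ∈ T, Metric.closedBall z r)ᶜ, g z ∂zeroMeasure h = 0 := by
    refine setIntegral_eq_zero_of_ae_eq_zero ?_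
    have hae : ∀ᵐ z ∂zeroMeasure h, z ∉ K' := measure_eq_zero_iff_ae_notMem.1 hK'0
    filter_upwards [hae] with z hz hzU
    by_contra hgz
    refine hz ⟨subset_tsupport _ hgz, fun hzb ↦ hzU ?_⟩
    exact Set.biUnion_mono subset_rfl (fun _ _ ↦ Metric.ball_subset_closedBall) hzb
  rw [← integral_add_compl hUm hgi, hout, add_zero, integral_biUnion_finset T
    (fun z _ ↦ Metric.isClosed_closedBall.measurableSet) hdisj fun z _ ↦ hgi.integrableOn,
    ← Finset.sum_sub_distrib, Finset.mul_sum]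
  refine (Finset.abs_sum_le_sum_abs _ _).trans (Finset.sum_le_sum fun z hz ↦ ?_)
  have hconst : (zeroMeasure f).real {z} * g z =
      ∫ _ in Metric.closedBall z r, g z ∂zeroMeasure h := by
    rw [setIntegral_const, hcnt z hz, smul_eq_mul]
  have hfinite : zeroMeasure h (Metric.closedBall z r) < ∞ := (hcomp z hz).measure_lt_top
  rw [hconst, ← integral_sub hgi.integrableOn (integrableOn_const hfinite.ne), ← hcnt z hz]
  exact norm_setIntegral_le_of_norm_le_const (f := fun w ↦ g w - g z) hfinite fun w hw ↦ ((hTr z hz).2 w hw).2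

theorem tendsto_integral_zeroMeasure {f : HolDisk} (hf : ∃ z, f z ≠ 0) (g : C_c(Disk, ℝ)) :
    Tendsto (fun h : HolDisk ↦ ∫ z, g z ∂zeroMeasure h) (𝓝 f) (𝓝 (∫ z, g z ∂zeroMeasure f)) := by
  have hfin := f.finite_zeroMult_ne_zero g.hasCompactSupport.isCompact
  have hT : ∀ z ∈ tsupport g, f z = 0 → z ∈ hfin.toFinset := fun z hz h0 ↦
    (Set.Finite.mem_toFinset hfin).2 ⟨hz, zeroMult_ne_zero hf h0⟩
  set M : ℝ := ∑ z ∈ hfin.toFinset, (zeroMeasure f).real {z} with hM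
  have hM0 : 0 ≤ M := Finset.sum_nonneg fun _ _ ↦ measureReal_nonneg
  refine Metric.tendsto_nhds.2 fun δ hδ ↦ ?_
  have hev := eventually_abs_integral_zeroMeasure_sub_le hf g hfin.toFinset hT
    (ε := δ / (4 * (M + 1))) (by positivity)
  have hδM : δ / (4 * (M + 1)) * M ≤ δ / 4 := by
    rw [div_mul_eq_mul_div, div_le_div_iff₀ (by positivity) (by positivity)]
    nlinarith
  -- The estimate also holds at `f` itself, so both integrals lie within `δ / 4` of the same finite
  -- sum, and the integral against `zeroMeasure f` need not be computed.
  have hself := hev.self_of_nhds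
  filter_upwards [hev] with h hh
  rw [Real.dist_eq, abs_lt]
  rw [abs_le] at hh hself
  constructor <;> linarith [hh.1, hh.2, hself.1, hself.2]

theorem continuousAt_zeroConfig {f : HolDisk} (hf : ∃ z, f z ≠ 0) :
    ContinuousAt zeroConfig f := by
  rw [ContinuousAt, nhds_iInf, tendsto_iInf]
  intro g
  rw [nhds_induced, tendsto_comap_iff]
  exact tendsto_integral_zeroMeasure hf g

/-- The zero function. -/
def zero : HolDisk := ofDifferentiableOn (fun _ ↦ 0) (differentiableOn_const 0)

theorem exists_ne_zero_of_ne {f : HolDisk} (hf : f ≠ zero) : ∃ z, f z ≠ 0 := by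
  by_contra! h
  exact hf (DFunLike.ext _ _ h)

theorem continuousOn_zeroConfig : ContinuousOn zeroConfig {zero}ᶜ := fun _ hf ↦
  (continuousAt_zeroConfig (exists_ne_zero_of_ne hf)).continuousWithinAt

/-- The conventional value at the zero function may break continuity there, but a single closed
point does not affect Borel measurability. -/
theorem measurable_zeroConfig : Measurable zeroConfig :=
  measurable_of_continuousOn_compl_singleton zero continuousOn_zeroConfig

end HolDisk

/-! ### Convergence in law of the zero processes -/

theorem TendstoInDistribution.zeroConfig {Ω : ℕ → Type*} [∀ n, MeasurableSpace (Ω n)]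
    {P : ∀ n, Measure (Ω n)} [∀ n, IsProbabilityMeasure (P n)]
    {Ω_lim : Type*} [MeasurableSpace Ω_lim]
    {P_lim : Measure Ω_lim} [IsProbabilityMeasure P_lim]
    {X : ∀ n, Ω n → HolDisk} {X_lim : Ω_lim → HolDisk}
    (h : TendstoInDistribution X atTop X_lim P P_lim) (h0 : ∀ᵐ ω ∂P_lim, X_lim ω ≠ HolDisk.zero) :
    TendstoInDistribution (fun n ω ↦ SpectralGAF.zeroConfig (X n ω)) atTop
      (fun ω ↦ SpectralGAF.zeroConfig (X_lim ω)) P P_lim := by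
  let : PseudoMetricSpace HolDisk := UniformSpace.pseudoMetricSpace HolDisk
  have hm := HolDisk.measurable_zeroConfig
  have h1 : ∀ n, AEMeasurable (X n) (P n) := h.forall_aemeasurable
  have h2 : AEMeasurable X_lim P_lim := h.aemeasurable_limit
  refine ⟨fun n ↦ hm.comp_aemeasurable (h1 n), hm.comp_aemeasurable h2, ?_⟩
  have key := tendsto_map_of_continuousOn h.tendsto hm isOpen_compl_singleton
    HolDisk.continuousOn_zeroConfig (by
      rw [compl_compl]
      refine (Measure.map_apply_of_aemeasurable h2 (measurableSet_singleton _)).trans ?_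
      exact measure_eq_zero_iff_ae_notMem.2 h0)
  have e₀ : (P_lim.map X_lim).map SpectralGAF.zeroConfig =
      P_lim.map fun ω ↦ SpectralGAF.zeroConfig (X_lim ω) :=
    AEMeasurable.map_map_of_aemeasurable hm.aemeasurable h2
  have e : ∀ n, ((P n).map (X n)).map SpectralGAF.zeroConfig =
      (P n).map fun ω ↦ SpectralGAF.zeroConfig (X n ω) := fun n ↦
    AEMeasurable.map_map_of_aemeasurable hm.aemeasurable (h1 n)
  refine (key.congr fun n ↦ Subtype.ext (e n)).trans_eq (congrArg 𝓝 (Subtype.ext e₀))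

end SpectralGAF

end

theorem corollary2
    (F : ℕ → ProbabilityMeasure SpectralGAF.Torus) (F_lim : ProbabilityMeasure SpectralGAF.Torus)
    (hF : Tendsto F atTop (𝓝 F_lim))
    {Ω : ℕ → Type*} [∀ n, MeasurableSpace (Ω n)]
    (P : ∀ n, Measure (Ω n)) [∀ n, IsProbabilityMeasure (P n)]
    {Ω_lim : Type*} [MeasurableSpace Ω_lim]
    (P_lim : Measure Ω_lim) [IsProbabilityMeasure P_lim]
    (X : ∀ n, Ω n → SpectralGAF.HolDisk) (X_lim : Ω_lim → SpectralGAF.HolDisk)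
    (hX : ∀ n, SpectralGAF.IsGAF (P n) (X n) (SpectralGAF.spectralKernel (F n)))
    (hX_lim : SpectralGAF.IsGAF P_lim X_lim (SpectralGAF.spectralKernel F_lim)) :
    TendstoInDistribution X atTop X_lim P P_lim ∧
      TendstoInDistribution (fun n ω => SpectralGAF.zeroConfig (X n ω)) atTop
        (fun ω => SpectralGAF.zeroConfig (X_lim ω)) P P_lim := by
  have h := SpectralGAF.tendstoInDistribution_of_tendsto hF hX hX_lim
  refine ⟨h, SpectralGAF.TendstoInDistribution.zeroConfig h ?_⟩
  filter_upwards [hX_lim.ae_ne_zero] with ω hω h0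
  exact hω (by rw [h0]; rfl)
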